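/- Let $d\ge 2$ and $k\ge 1$ be integers. An $m$-dimensional polytope in $\mathbb{R}^d$ is a (not necessarily convex) finite union of $m$-simplices lying in one $m$-dimensional affine subspace, with connected relative interior. A polytopal partition $\mathcal{T}_h$ of a bounded connected open set $\Omega\subset\mathbb{R}^d$ is a finite family of $d$-dimensional polytopes $T$ with pairwise disjoint interiors and union $\overline\Omega$, where each boundary $\partial T$ is the union of finitely many flat sides $e$ (edges if $d=2$, faces if $d=3$), which are $(d-1)$-dimensional polytopes, such that two different sides (of the same or of different elements) overlap in a set of zero $(d-1)$-dimensional measure. Write $h_T$ and $h_e$ for the diameters of $T$ and $e$, and $|T|$ and $|e|$ for their $d$- and $(d-1)$-dimensional measures. The partition is shape regular with parameters $\varrho_v,\varrho_e,\kappa,\sigma^*>0$, $\theta_0\in[0,\pi/2)$, $N\in\mathbb{N}$ if for every $T\in\mathcal{T}_h$ and every side $e$ of $T$: (1) $\varrho_v h_T^d\le |T|$ and $\varrho_e h_e^{d-1}\le |e|$; (2) $\kappa h_T\le h_e$; (3) there is a point $A_e\in T$ such that the pyramid $\bigcup_{x\in e}[x,A_e]$ with base $e$ and apex $A_e$ is contained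 in $T$, has height at least $\sigma^* h_T$, and the angle between $x-A_e$ and the outward unit normal of $e$ is at most $\theta_0$ for all $x\in e$; (4) at most $N$ sides of $T$ are non-convex (no condition if $d=2$ or if all sides are convex). Let $\mathsf{RM}=\{x\mapsto a+\eta x:\ a\in\mathbb{R}^d,\ \eta\in\mathbb{R}^{d\times d},\ \eta^T=-\eta\}$, let $P_m$ be the space of polynomials of total degree at most $m$, and for each side $e$ let $Q_b$ be the $L^2(e)$-orthogonal projection onto the space $V_{k-1}(e)$ of restrictions to $e$ of the fields in $[P_{k-1}]^d+\mathsf{RM}$. Let $\varepsilon(v)=\frac12(\nabla v+\nabla v^T)$, $\|\varepsilon(v)\|_T^2=\int_T\sum_{i,j}\varepsilon_{ij}(v)^2\,dx$, and $\|v-Q_bv\|_{\partial T}^2=\sum_{e\subset\partial T}\int_e|v-Q_bv|^2\,ds$, the sum being over the sides $e$ of $T$. Then there is a constant $C>0$, depending only on $d$, $k$ and the parameters $\varrho_v,\varrho_e,\kappa,\sigma^*,\theta_0,N$, such that for every bounded connected open set $\Omega$, every polytopal partition $\mathcal{T}_h$ of $\Omega$ that is shape regular with these parameters, every $T\in\mathcal{T}_h$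 and every $v_0\in[P_k(T)]^d$, $$\|v_0-Q_bv_0\|_{\partial T}^2\le C\,h_T\,\|\varepsilon(v_0)\|_T^2 .$$ -/

import Mathlib

open MeasureTheory
open scoped MeasureTheory

noncomputable section

namespace WG

/-- Euclidean space `ℝ^d`. -/
abbrev E (d : ℕ) : Type := EuclideanSpace ℝ (Fin d)

/-! ### Polynomial vector fields, rigid motions, strain -/

/-- `[P_m]^d`: vector fields all of whose components are polynomials of total degree at most `m`. -/
def polyField (d m : ℕ) : Submodule ℝ (E d → E d) where
  carrier := {v | ∀ i, ∃ p : MvPolynomial (Fin d) ℝ, p.totalDegree ≤ m ∧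
    ∀ x, v x i = MvPolynomial.eval (fun j => x j) p}
  add_mem' := by
    intro v w hv hw i
    obtain ⟨p, hp, hpv⟩ := hv i
    obtain ⟨q, hq, hqw⟩ := hw i
    exact ⟨p + q, (MvPolynomial.totalDegree_add p q).trans (max_le hp hq),
      fun x => by simp [hpv, hqw]⟩
  zero_mem' := fun i => ⟨0, by simp, fun x => by simp⟩
  smul_mem' := by
    intro c v hv i
    obtain ⟨p, hp, hpv⟩ := hv i
    exact ⟨c • p, (MvPolynomial.totalDegree_smul_le c p).trans hp, fun x => by simp [hpv]⟩

/-- `RM`: the rigid motions `x ↦ a + η x` with `η` a skew-symmetric matrix. -/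
def rigidMotion (d : ℕ) : Submodule ℝ (E d → E d) where
  carrier := {v | ∃ (a : E d) (η : Matrix (Fin d) (Fin d) ℝ), η.transpose = -η ∧
    ∀ x i, v x i = a i + ∑ j, η i j * x j}
  add_mem' := by
    rintro v w ⟨a, η, hη, hv⟩ ⟨b, θ, hθ, hw⟩
    refine ⟨a + b, η + θ, ?_, fun x i => ?_⟩
    · rw [Matrix.transpose_add, hη, hθ, neg_add]
    · simp only [Pi.add_apply, PiLp.add_apply, hv, hw, Matrix.add_apply, add_mul,
        Finset.sum_add_distrib]
      ring
  zero_mem' := ⟨0, 0, by simp, fun x i => by simp⟩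
  smul_mem' := by
    rintro c v ⟨a, η, hη, hv⟩
    refine ⟨c • a, c • η, ?_, fun x i => ?_⟩
    · rw [Matrix.transpose_smul, hη, smul_neg]
    · simp only [Pi.smul_apply, PiLp.smul_apply, hv, Matrix.smul_apply, smul_eq_mul, mul_add,
        Finset.mul_sum, mul_assoc]

/-- The strain tensor `ε(v) = (∇v + ∇vᵀ) / 2`. -/
def strain {d : ℕ} (v : E d → E d) (x : E d) (i j : Fin d) : ℝ :=
  (fderiv ℝ v x (EuclideanSpace.single j 1) i + fderiv ℝ v x (EuclideanSpace.single i 1) j) / 2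

/-- `‖ε(v)‖²_T`. -/
def strainNormSq {d : ℕ} (v : E d → E d) (T : Set (E d)) : ℝ :=
  ∫ x in T, ∑ i, ∑ j, strain v x i j ^ 2

/-! ### The projection `Q_b` -/

/-- The `(d-1)`-dimensional surface measure on a flat side `e`. -/
def sideMeasure {d : ℕ} (e : Set (E d)) : Measure (E d) := μHE[d - 1].restrict e

/-- `[P_{k-1}]^d + RM`. -/
def sideField (d k : ℕ) : Submodule ℝ (E d → E d) := polyField d (k - 1) ⊔ rigidMotion d

/-- `V_{k-1}(e)`: the space of traces on `e` of the fields in `[P_{k-1}]^d + RM`, as a subspace of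
`[L²(e)]^d`. -/
def sideSpace {d : ℕ} (k : ℕ) (e : Set (E d)) : Submodule ℝ (Lp (E d) 2 (sideMeasure e)) where
  carrier := {f | ∃ p ∈ sideField d k, f =ᵐ[sideMeasure e] p}
  add_mem' := by
    rintro f g ⟨p, hp, hf⟩ ⟨q, hq, hg⟩
    exact ⟨p + q, add_mem hp hq, (Lp.coeFn_add f g).trans (hf.add hg)⟩
  zero_mem' := ⟨0, zero_mem _, Lp.coeFn_zero _ _ _⟩
  smul_mem' := by
    rintro c f ⟨p, hp, hf⟩
    exact ⟨c • p, Submodule.smul_mem _ c hp, (Lp.coeFn_smul c f).trans (hf.const_smul c)⟩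

instance polyField_finite (d m : ℕ) : FiniteDimensional ℝ (polyField d m) := by
  let L : (Fin d → MvPolynomial.restrictTotalDegree (Fin d) ℝ m) →ₗ[ℝ] (E d → E d) :=
    { toFun := fun p x => WithLp.toLp 2 fun i =>
        MvPolynomial.eval (fun j => x j) (p i : MvPolynomial (Fin d) ℝ)
      map_add' := fun p q => by ext x i; simp
      map_smul' := fun c p => by ext x i; simp }
  have h : polyField d m ≤ LinearMap.range L := by
    intro v hv
    choose p hp hpv using hv
    refine ⟨fun i => ⟨p i, (MvPolynomial.mem_restrictTotalDegree _ _ _).2 (hp i)⟩, ?_⟩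
    ext x i
    simp [L, hpv]
  exact Submodule.finiteDimensional_of_le h

theorem rigidMotion_le (d : ℕ) : rigidMotion d ≤ polyField d 1 := by
  rintro v ⟨a, η, -, hv⟩ i
  refine ⟨MvPolynomial.C (a i) + ∑ j, MvPolynomial.C (η i j) * MvPolynomial.X j, ?_,
    fun x => by simp [hv]⟩
  refine (MvPolynomial.totalDegree_add _ _).trans (max_le (by simp) ?_)
  refine (MvPolynomial.totalDegree_finsetSum _ _).trans (Finset.sup_le fun j _ => ?_)
  refine (MvPolynomial.totalDegree_mul _ _).trans ?_
  simp

instance sideField_finite (d k : ℕ) : FiniteDimensional ℝ (sideField d k) := by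
  have : FiniteDimensional ℝ (rigidMotion d) :=
    Submodule.finiteDimensional_of_le (rigidMotion_le d)
  unfold sideField
  infer_instance

instance sideSpace_finite {d : ℕ} (k : ℕ) (e : Set (E d)) :
    FiniteDimensional ℝ (sideSpace k e) := by
  let S : Submodule ℝ (sideField d k) :=
    { carrier := {p | MemLp (p : E d → E d) 2 (sideMeasure e)}
      add_mem' := fun hp hq => MemLp.add hp hq
      zero_mem' := MemLp.zero'
      smul_mem' := fun c _ hp => MemLp.const_smul hp c }
  let L : S →ₗ[ℝ] Lp (E d) 2 (sideMeasure e) :=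
    { toFun := fun p => MemLp.toLp (p.1 : E d → E d) p.2
      map_add' := fun _ _ => rfl
      map_smul' := fun _ _ => rfl }
  have h : sideSpace k e ≤ LinearMap.range L := by
    rintro f ⟨p, hp, hf⟩
    have hm : MemLp p 2 (sideMeasure e) := (memLp_congr_ae hf).1 (Lp.memLp f)
    refine ⟨⟨⟨p, hp⟩, hm⟩, ?_⟩
    apply Lp.ext
    exact (MemLp.coeFn_toLp hm).trans hf.symm
  exact Submodule.finiteDimensional_of_le h

open Classical in
/-- `Q_b v` on the side `e`: the `L²(e)`-orthogonal projection of `v|_e` onto `V_{k-1}(e)` (defined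
up to null sets of the surface measure; set to zero if `v|_e` is not square integrable, which does
not happen for polynomial fields on bounded flat sides, see `memLp_side`). -/
def Qb {d : ℕ} (k : ℕ) (e : Set (E d)) (v : E d → E d) : E d → E d :=
  if h : MemLp v 2 (sideMeasure e) then
    ((sideSpace k e).starProjection (MemLp.toLp v h) : Lp (E d) 2 (sideMeasure e))
  else 0

/-- `‖v - Q_b v‖²_e` on one side `e`. -/
def sideErrorSq {d : ℕ} (k : ℕ) (v : E d → E d) (e : Set (E d)) : ℝ :=
  ∫ x, ‖v x - Qb k e v x‖ ^ 2 ∂(sideMeasure e)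

/-! ### Polytopal partitions -/

/-- `P` is a (not necessarily convex) closed `m`-dimensional polytope in `ℝ^d`: it lies in an
`m`-dimensional affine subspace, it is a finite union of `m`-simplices, and its relative interior
is connected. -/
def IsPolytope {d : ℕ} (m : ℕ) (P : Set (E d)) : Prop :=
  (∃ A : AffineSubspace ℝ (E d), Module.finrank ℝ A.direction = m ∧ P ⊆ A) ∧
  (∃ S : Finset (Finset (E d)),
    (∀ s ∈ S, s.card = m + 1 ∧ AffineIndependent ℝ ((↑) : s → E d)) ∧
    P = ⋃ s ∈ S, convexHull ℝ (s : Set (E d))) ∧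
  IsConnected (intrinsicInterior ℝ P)

/-- A finite partition of `Ω` into closed polytopes (polygons if `d = 2`, polyhedra if `d = 3`),
with the flat sides (edges if `d = 2`, faces if `d = 3`) of its elements. Two different sides, of
one element or of two, overlap in a null set only, so a side that two elements share is the same
for both; several sides of an element may lie in one hyperplane (hanging nodes). -/
structure PolytopalPartition (d : ℕ) (Ω : Set (E d)) where
  elements : Finset (Set (E d))
  sides : Set (E d) → Finset (Set (E d))
  isPolytope : ∀ T ∈ elements, IsPolytope d T
  cover : ⋃ T ∈ elements, T = closure Ω
  disjoint : ∀ T ∈ elements, ∀ T' ∈ elements, T ≠ T' → Disjoint (interior T) (interior T')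
  isPolytope_side : ∀ T ∈ elements, ∀ e ∈ sides T, IsPolytope (d - 1) e
  boundary : ∀ T ∈ elements, ⋃ e ∈ sides T, e = frontier T
  sides_overlap : ∀ T ∈ elements, ∀ T' ∈ elements, ∀ e ∈ sides T, ∀ e' ∈ sides T', e ≠ e' →
    μHE[d - 1] (e ∩ e') = 0

/-- `‖v - Q_b v‖²_{∂T}`, where `Q_b` acts on each side of `T` separately. -/
def PolytopalPartition.boundaryErrorSq {d : ℕ} {Ω : Set (E d)} (𝒯 : PolytopalPartition d Ω)
    (k : ℕ) (v : E d → E d) (T : Set (E d)) : ℝ :=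
  ∑ e ∈ 𝒯.sides T, sideErrorSq k v e

/-- Shape regularity parameters. -/
structure ShapeParams where
  ρv : ℝ
  ρe : ℝ
  κ : ℝ
  σ : ℝ
  θ : ℝ
  N : ℕ
  ρv_pos : 0 < ρv
  ρe_pos : 0 < ρe
  κ_pos : 0 < κ
  σ_pos : 0 < σ
  θ_nonneg : 0 ≤ θ
  θ_lt : θ < Real.pi / 2

/-- The side `e` is the base of a pyramid contained in `T` whose height is at least `σ h_T`, such
that the angle between `x - A` (`A` the apex, `x ∈ e`) and the normal `n` to `e` pointing out of
the pyramid is at most `θ`. -/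
def HasPyramid {d : ℕ} (T e : Set (E d)) (σ θ : ℝ) : Prop :=
  ∃ (A n : E d) (c : ℝ), A ∈ T ∧ ‖n‖ = 1 ∧ (∀ x ∈ e, inner ℝ n x = c) ∧
    (⋃ x ∈ e, segment ℝ x A) ⊆ T ∧
    σ * Metric.diam T ≤ c - inner ℝ n A ∧
    ∀ x ∈ e, InnerProductGeometry.angle (x - A) n ≤ θ

/-- Shape regularity of a polytopal partition with given parameters. -/
structure PolytopalPartition.ShapeRegular {d : ℕ} {Ω : Set (E d)} (𝒯 : PolytopalPartition d Ω)
    (s : ShapeParams) : Prop where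
  volume_ge : ∀ T ∈ 𝒯.elements, s.ρv * Metric.diam T ^ d ≤ volume.real T
  area_ge : ∀ T ∈ 𝒯.elements, ∀ e ∈ 𝒯.sides T,
    s.ρe * Metric.diam e ^ (d - 1) ≤ (μHE[d - 1]).real e
  diam_side_ge : ∀ T ∈ 𝒯.elements, ∀ e ∈ 𝒯.sides T, s.κ * Metric.diam T ≤ Metric.diam e
  pyramid : ∀ T ∈ 𝒯.elements, ∀ e ∈ 𝒯.sides T, HasPyramid T e s.σ s.θ
  /-- At most `N` sides of an element are non-convex (this is empty for `d = 2`). -/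
  nonconvex_sides : ∀ T ∈ 𝒯.elements, {e | e ∈ 𝒯.sides T ∧ ¬ Convex ℝ e}.ncard ≤ s.N

/-! ### `Q_b v` is never the default value on a side -/

theorem IsPolytope.isCompact {d m : ℕ} {P : Set (E d)} (h : IsPolytope m P) : IsCompact P := by
  obtain ⟨-, ⟨S, -, rfl⟩, -⟩ := h
  exact S.isCompact_biUnion fun s _ => Set.Finite.isCompact_convexHull (𝕜 := ℝ) s.finite_toSet

theorem IsPolytope.measure_lt_top {d m : ℕ} {P : Set (E d)} (h : IsPolytope m P) :
    μHE[m] P < ⊤ := by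
  have hc := h.isCompact
  obtain ⟨⟨A, hA, hP⟩, -, hne⟩ := h
  obtain ⟨x, hx⟩ := hne.nonempty
  have hxP : x ∈ P := intrinsicInterior_subset hx
  have : Nonempty A := ⟨⟨x, hP hxP⟩⟩
  have himg : P = ((↑) : A → E d) '' (((↑) : A → E d) ⁻¹' P) := by
    rw [Set.image_preimage_eq_inter_range, Subtype.range_coe]
    exact (Set.inter_eq_left.2 hP).symm
  have hcA : IsCompact (((↑) : A → E d) ⁻¹' P) :=
    (AffineSubspace.closed_of_finiteDimensional A).isClosedEmbedding_subtypeVal.isCompact_preimage hc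
  let p : A := ⟨x, hP hxP⟩
  rw [himg, AffineSubspace.euclideanHausdorffMeasure_coe_image, ← hA,
    EuclideanGeometry.euclideanHausdorffMeasure_eq p,
    Measure.map_apply (IsometryEquiv.vaddConst p).continuous.measurable hcA.measurableSet]
  exact ((IsometryEquiv.vaddConst p).toHomeomorph.isCompact_preimage.2 hcA).measure_lt_top

theorem polyField_continuous {d k : ℕ} {v : E d → E d} (hv : v ∈ polyField d k) :
    Continuous v := by
  have h : Continuous fun x => (v x).ofLp := by
    refine continuous_pi fun i => ?_
    obtain ⟨p, -, hp⟩ := hv i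
    simp_rw [hp]
    exact (MvPolynomial.continuous_eval p).comp (PiLp.continuous_ofLp 2 _)
  exact (PiLp.continuous_toLp 2 _).comp h

theorem memLp_side {d k : ℕ} {e : Set (E d)} (h : IsPolytope (d - 1) e) {v : E d → E d}
    (hv : v ∈ polyField d k) : MemLp v 2 (sideMeasure e) := by
  have : IsFiniteMeasure (sideMeasure e) :=
    ⟨by rw [sideMeasure, Measure.restrict_apply_univ]; exact h.measure_lt_top⟩
  have hcont := polyField_continuous hv
  obtain ⟨C, hC⟩ := h.isCompact.exists_bound_of_continuousOn hcont.continuousOn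
  refine MemLp.of_bound hcont.aestronglyMeasurable C ?_
  exact (ae_restrict_iff' h.isCompact.measurableSet).2 (Filter.Eventually.of_forall hC)

end WG

end

open MeasureTheory
open scoped MeasureTheory

noncomputable section

namespace WG

open Set Filter Topology
open scoped Pointwise

/-! On every side the projection is a best approximation and the traces of rigid motions lie in its
range, so `Q_b v` may be replaced by one rigid motion `r`, the same for all sides of `T`
(`sideErrorSq_le`). It remains to bound `|v - r|²` pointwise on `T` by the strain, the area of each
side, and the number of sides. After translation and scaling by `h_T` the element lies in the unit
ball; scaling back gives `h² · h^{-d} · h^{d-1} = h`.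

The pointwise bound (`exists_rigidMotion_sub_le`) is a Korn inequality on a finite-dimensional
space. Modulo strain-free fields, which are rigid motions, the coefficient vectors of norm one form
a compact set, and `|ε|²` is then a nonzero polynomial. Its sublevel sets are therefore uniformly
small in measure, and any subset of the ball of measure at least `ρ` keeps measure `ρ/2` where
`|ε|²` exceeds a fixed `δ`. No regularity of the subset enters, and the constant does not depend on
it.

At most `N` sides are non-convex. The convex ones are counted by compactness
(`exists_card_fatFaces_le`). A lower bound on area and on pyramid height yields `d` points of the
side which, with the apex, span a simplex of determinant bounded below. Such simplices form a
compact set, covered by finitely many neighbourhoods of similar simplices. Two sides with simplices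
in one neighbourhood must coincide in a ball: otherwise a boundary point of `T` would lie inside a
pyramid contained in `T`. They would then overlap in positive area, so each neighbourhood accounts
for at most one side. -/

/-! ### Null sets and sublevel sets -/

/-- A closed set that meets every line through `y` in a countable set is Lebesgue null. -/
theorem volume_eq_zero_of_countable_lines {n : ℕ} {Z : Set (E n)} (hZ : IsClosed Z) (y : E n)
    (h : ∀ x, {t : ℝ | y + t • x ∈ Z}.Countable) : volume Z = 0 := by
  have hS : MeasurableSet {q : ℝ × E n | y + q.1 • q.2 ∈ Z} :=
    (hZ.preimage (f := fun q : ℝ × E n => y + q.1 • q.2) (by fun_prop)).measurableSet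
  -- Fubini for the pairs `(t, x)` with `y + t • x ∈ Z`: each section in `t` is countable, hence
  -- null, so almost every section in `x` is null. For `t ≠ 0` that section is an affine copy of
  -- `Z`.
  have h0 : (volume.prod volume : Measure (ℝ × E n)) {q : ℝ × E n | y + q.1 • q.2 ∈ Z} = 0 := by
    rw [Measure.prod_apply_symm hS]
    simp only [lintegral_eq_zero_iff (measurable_measure_prodMk_right hS)]
    exact Eventually.of_forall fun x => (h x).measure_zero volume
  rw [Measure.measure_prod_null hS] at h0
  obtain ⟨t, ht, ht0⟩ : ∃ t : ℝ, volume {x : E n | y + t • x ∈ Z} = 0 ∧ t ≠ 0 := by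
    have h1 : ∀ᵐ t : ℝ, t ≠ 0 := by simp [ae_iff]
    exact (h0.and h1).exists.imp fun t ht => ⟨ht.1, ht.2⟩
  have h2 : {x : E n | y + t • x ∈ Z} = (fun x => t • x) ⁻¹' ((fun x => y + x) ⁻¹' Z) := rfl
  rw [h2, Measure.addHaar_preimage_smul _ ht0, mul_eq_zero] at ht
  rcases ht with ht | ht
  · simp [ht0] at ht
  · rwa [measure_preimage_add] at ht

/-- If no member of a compact family of continuous functions vanishes on a set of positive measure,
the sublevel sets `{|F v| ≤ δ}` are uniformly small. -/
theorem exists_measure_sublevel_lt {n : ℕ} {X : Type*} [TopologicalSpace X] {S : Set X}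
    (hS : IsCompact S) {B : Set (E n)} (hB : IsCompact B) {F : X → E n → ℝ}
    (hF : Continuous fun q : X × E n => F q.1 q.2)
    (h0 : ∀ v ∈ S, volume {x ∈ B | F v x = 0} = 0) {c : ENNReal} (hc : 0 < c) :
    ∃ δ : ℝ, 0 < δ ∧ ∀ v ∈ S, volume {x ∈ B | |F v x| ≤ δ} < c := by
  have key : ∀ v ∈ S, ∃ ε : ℝ, 0 < ε ∧ ∀ᶠ v' in 𝓝[S] v, volume {x ∈ B | |F v' x| ≤ ε} < c := by
    intro v hv
    -- These sublevel sets decrease to the zero set, so continuity of the measure from above makes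
    -- one of them smaller than `c`.
    let A : ℕ → Set (E n) := fun m => {x ∈ B | |F v x| ≤ 1 / ((m : ℝ) + 1)}
    have hFv : Continuous (F v) := hF.comp (by fun_prop : Continuous fun x : E n => (v, x))
    have hAm : ∀ m, MeasurableSet (A m) := fun m =>
      hB.measurableSet.inter (isClosed_le (continuous_abs.comp hFv) continuous_const).measurableSet
    have hA : Antitone A := by
      intro a b hab x hx
      refine ⟨hx.1, hx.2.trans ?_⟩
      have : (a : ℝ) ≤ b := by exact_mod_cast hab
      gcongr
    have hfin : ∃ m, volume (A m) ≠ ⊤ := ⟨0, ((measure_mono fun x hx => hx.1).trans_lt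
      hB.measure_lt_top).ne⟩
    have hlim := tendsto_measure_iInter_atTop (μ := volume)
      (fun m => (hAm m).nullMeasurableSet) hA hfin
    have hI : ⋂ m, A m = {x ∈ B | F v x = 0} := by
      ext x
      simp only [A, mem_iInter, mem_ofPred_eq]
      refine ⟨fun hx => ⟨(hx 0).1, ?_⟩, fun hx m => ⟨hx.1, by rw [hx.2, abs_zero]; positivity⟩⟩
      have : |F v x| ≤ 0 :=
        ge_of_tendsto' tendsto_one_div_add_atTop_nhds_zero_nat fun m => (hx m).2
      exact abs_nonpos_iff.1 this
    rw [hI, h0 v hv] at hlim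
    obtain ⟨m, hm⟩ := (hlim.eventually (gt_mem_nhds hc)).exists
    set η : ℝ := 1 / ((m : ℝ) + 1) with hη
    have hη0 : 0 < η := by positivity
    -- The other half of `η` absorbs the change from `F v` to `F v'`, which is uniform on the
    -- compact set `B`.
    refine ⟨η / 2, by positivity, ?_⟩
    have hev : ∀ᶠ v' in 𝓝 v, ∀ x ∈ B, |F v' x - F v x| < η / 2 := by
      exact hB.eventually_forall_of_forall_eventually (x₀ := v)
        (P := fun v' x => |F v' x - F v x| < η / 2) (fun x _ => by
          have hc : Continuous fun q : X × E n => |F q.1 q.2 - F v q.2| :=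
            continuous_abs.comp (hF.sub (hFv.comp continuous_snd))
          have := (hc.tendsto (v, x)).eventually_lt_const (u := η / 2) (by simpa using hη0)
          exact this)
    filter_upwards [mem_nhdsWithin_of_mem_nhds hev] with v' hv'
    refine (measure_mono ?_).trans_lt hm
    rintro x ⟨hxB, hx⟩
    refine ⟨hxB, ?_⟩
    have h1 := hv' x hxB
    have h2 : |F v x| ≤ |F v' x| + |F v' x - F v x| := by
      rw [abs_sub_comm]
      simpa using abs_add_le (F v' x) (F v x - F v' x)
    change |F v x| ≤ η
    linarith
  refine hS.induction_on (p := fun S => ∃ δ : ℝ, 0 < δ ∧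
    ∀ v ∈ S, volume {x ∈ B | |F v x| ≤ δ} < c) ⟨1, one_pos, by simp⟩ ?_ ?_ ?_
  · rintro s t hst ⟨δ, hδ, h⟩
    exact ⟨δ, hδ, fun v hv => h v (hst hv)⟩
  · rintro s t ⟨δ, hδ, h⟩ ⟨δ', hδ', h'⟩
    refine ⟨min δ δ', lt_min hδ hδ', ?_⟩
    rintro v (hv | hv)
    · exact (measure_mono (t := {x ∈ B | |F v x| ≤ δ})
        fun x hx => ⟨hx.1, hx.2.trans (min_le_left _ _)⟩).trans_lt (h v hv)
    · exact (measure_mono (t := {x ∈ B | |F v x| ≤ δ'})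
        fun x hx => ⟨hx.1, hx.2.trans (min_le_right _ _)⟩).trans_lt (h' v hv)
  · intro v hv
    obtain ⟨ε, hε, h⟩ := key v hv
    exact ⟨_, h, ε, hε, fun v hv => hv⟩

/-! ### Derivatives of polynomials -/

theorem hasFDerivAt_eval {n : ℕ} (p : MvPolynomial (Fin n) ℝ) (x : E n) :
    HasFDerivAt (fun x : E n => MvPolynomial.eval (fun j => x j) p)
      (∑ j, MvPolynomial.eval (fun j => x j) (MvPolynomial.pderiv j p) •
        (EuclideanSpace.proj j : E n →L[ℝ] ℝ)) x := by
  induction p using MvPolynomial.induction_on with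
  | C a => simpa using hasFDerivAt_const a x
  | add p q hp hq =>
    simp only [map_add, add_smul, Finset.sum_add_distrib]
    exact hp.add hq
  | mul_X p i hp =>
    have h : HasFDerivAt (fun x : E n => x i) (EuclideanSpace.proj i : E n →L[ℝ] ℝ) x :=
      (EuclideanSpace.proj i : E n →L[ℝ] ℝ).hasFDerivAt
    simp only [map_mul, MvPolynomial.eval_X]
    refine (hp.mul h).congr_fderiv ?_
    ext y
    simp only [Derivation.leibniz, MvPolynomial.pderiv_X, smul_eq_mul, map_add, map_mul,
      MvPolynomial.eval_X, add_smul, Finset.sum_add_distrib, add_apply,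
      smul_apply, sum_apply, Pi.single_apply, mul_ite,
      mul_one, mul_zero, Finset.mul_sum]
    simp [apply_ite, mul_assoc, ite_mul]

/-- A polynomial that vanishes on a set of positive measure vanishes everywhere. -/
theorem volume_zero_set_eval {n : ℕ} {p : MvPolynomial (Fin n) ℝ} {y : E n}
    (hy : MvPolynomial.eval (fun j => y j) p ≠ 0) :
    volume {x : E n | MvPolynomial.eval (fun j => x j) p = 0} = 0 := by
  have hc : Continuous fun x : E n => MvPolynomial.eval (fun j => x j) p :=
    (MvPolynomial.continuous_eval p).comp (PiLp.continuous_ofLp 2 _)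
  refine volume_eq_zero_of_countable_lines (isClosed_eq hc continuous_const) y fun x => ?_
  -- Restriction of `p` to the line through `y` in direction `x`; it is nonzero at `t = 0`, so it
  -- has finitely many roots.
  let q : Polynomial ℝ := MvPolynomial.aeval
    (fun j => Polynomial.C (y j) + Polynomial.X * Polynomial.C (x j)) p
  have hq : ∀ t : ℝ, q.eval t = MvPolynomial.eval (fun j => (y + t • x) j) p := by
    intro t
    have : (Polynomial.evalRingHom t).comp (MvPolynomial.aeval
        (fun j => Polynomial.C (y j) + Polynomial.X * Polynomial.C (x j)) :
          MvPolynomial (Fin n) ℝ →ₐ[ℝ] Polynomial ℝ).toRingHom =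
        MvPolynomial.eval (fun j => (y + t • x) j) := by
      ext j <;> simp
      exact mul_comm _ _
    exact congrArg (fun f => f p) this
  have hq0 : q ≠ 0 := by
    intro h
    have := hq 0
    simp [h] at this
    exact hy this.symm
  refine (Polynomial.finite_setOfPred_isRoot hq0).countable.mono fun t ht => ?_
  simpa [Polynomial.IsRoot, hq] using ht

/-! ### Korn's inequality for polynomial fields -/

theorem polyField_differentiable {d k : ℕ} {v : E d → E d} (hv : v ∈ polyField d k) :
    Differentiable ℝ v := by
  rw [differentiable_euclidean]
  intro i
  obtain ⟨p, -, hp⟩ := hv i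
  simp_rw [hp]
  exact fun x => (hasFDerivAt_eval p x).differentiableAt

theorem fderiv_apply_of_eval {d : ℕ} {v : E d → E d} (hv : Differentiable ℝ v) {i : Fin d}
    {p : MvPolynomial (Fin d) ℝ} (hp : ∀ x, v x i = MvPolynomial.eval (fun j => x j) p)
    (x : E d) (j : Fin d) :
    fderiv ℝ v x (EuclideanSpace.single j 1) i =
      MvPolynomial.eval (fun j => x j) (MvPolynomial.pderiv j p) := by
  have h1 : HasFDerivAt (fun y => v y i)
      ((EuclideanSpace.proj i : E d →L[ℝ] ℝ).comp (fderiv ℝ v x)) x :=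
    (EuclideanSpace.proj i : E d →L[ℝ] ℝ).hasFDerivAt.comp x (hv x).hasFDerivAt
  simp_rw [hp] at h1
  have h2 := congrArg (fun L : E d →L[ℝ] ℝ => L (EuclideanSpace.single j 1))
    (h1.unique (hasFDerivAt_eval p x))
  simpa [sum_apply, Pi.single_apply] using h2

theorem strain_eq_eval {d k : ℕ} {v : E d → E d} (hv : v ∈ polyField d k) (i j : Fin d) :
    ∃ q : MvPolynomial (Fin d) ℝ, ∀ x, strain v x i j = MvPolynomial.eval (fun j => x j) q := by
  have hd := polyField_differentiable hv
  choose p _ hp using hv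
  refine ⟨MvPolynomial.C (1 / 2) * (MvPolynomial.pderiv j (p i) + MvPolynomial.pderiv i (p j)),
    fun x => ?_⟩
  rw [strain, fderiv_apply_of_eval hd (hp i), fderiv_apply_of_eval hd (hp j)]
  simp only [map_mul, map_add, MvPolynomial.eval_C]
  ring

theorem strain_continuous {d k : ℕ} {v : E d → E d} (hv : v ∈ polyField d k) (i j : Fin d) :
    Continuous fun x => strain v x i j := by
  obtain ⟨q, hq⟩ := strain_eq_eval hv i j
  simp_rw [hq]
  exact (MvPolynomial.continuous_eval q).comp (PiLp.continuous_ofLp 2 _)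

theorem eval_eq_eval_zero_of_pderiv {d : ℕ} {p : MvPolynomial (Fin d) ℝ}
    (hp : ∀ (x : E d) j, MvPolynomial.eval (fun j => x j) (MvPolynomial.pderiv j p) = 0) (x : E d) :
    MvPolynomial.eval (fun j => x j) p = MvPolynomial.eval (fun j => (0 : E d) j) p := by
  refine is_const_of_fderiv_eq_zero (𝕜 := ℝ)
    (f := fun x : E d => MvPolynomial.eval (fun j => x j) p)
    (fun x => (hasFDerivAt_eval p x).differentiableAt) (fun x => ?_) x 0
  rw [(hasFDerivAt_eval p x).fderiv]
  simp [hp]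

/-- The commutator of two derivations is a derivation, and this one kills the variables. -/
theorem pderiv_comm {d : ℕ} (i j : Fin d) (p : MvPolynomial (Fin d) ℝ) :
    MvPolynomial.pderiv i (MvPolynomial.pderiv j p) =
      MvPolynomial.pderiv j (MvPolynomial.pderiv i p) := by
  have h : ⁅(MvPolynomial.pderiv i : Derivation ℝ (MvPolynomial (Fin d) ℝ) _),
      (MvPolynomial.pderiv j : Derivation ℝ (MvPolynomial (Fin d) ℝ) _)⁆ = 0 := by
    apply MvPolynomial.derivation_ext
    intro k
    rw [Derivation.commutator_apply]
    simp [MvPolynomial.pderiv_X, Pi.single_apply, apply_ite]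
  have := congrArg (fun D => D p) h
  simpa [Derivation.commutator_apply, sub_eq_zero] using this

/-- A polynomial field with vanishing strain is a rigid motion. -/
theorem mem_rigidMotion_of_strain_eq_zero {d k : ℕ} {v : E d → E d} (hv : v ∈ polyField d k)
    (h : ∀ x i j, strain v x i j = 0) : v ∈ rigidMotion d := by
  have hd := polyField_differentiable hv
  choose p _ hp using hv
  have hanti : ∀ i j, MvPolynomial.pderiv j (p i) = -MvPolynomial.pderiv i (p j) := by
    intro i j
    refine MvPolynomial.funext fun x => ?_
    have := h (WithLp.toLp 2 x) i j
    rw [strain, fderiv_apply_of_eval hd (hp i), fderiv_apply_of_eval hd (hp j)] at this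
    simp only [map_neg]
    linarith
  -- `∂ₗ∂ⱼvᵢ` is symmetric in `l, j` and antisymmetric in `i, j`; alternating the two symmetries
  -- three times turns it into its own negative.
  have hsecond : ∀ i j l, MvPolynomial.pderiv l (MvPolynomial.pderiv j (p i)) = 0 := by
    intro i j l
    have h1 : MvPolynomial.pderiv l (MvPolynomial.pderiv j (p i)) =
        -MvPolynomial.pderiv l (MvPolynomial.pderiv j (p i)) := by
      conv_lhs => rw [hanti i j, map_neg, pderiv_comm, hanti j l, map_neg, neg_neg, pderiv_comm,
        hanti l i, map_neg, pderiv_comm]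
    exact self_eq_neg.1 h1
  have hgrad : ∀ i j (x : E d), MvPolynomial.eval (fun j => x j) (MvPolynomial.pderiv j (p i)) =
      MvPolynomial.eval (fun j => (0 : E d) j) (MvPolynomial.pderiv j (p i)) := fun i j x =>
    eval_eq_eval_zero_of_pderiv (fun x l => by rw [hsecond]; simp) x
  let η : Matrix (Fin d) (Fin d) ℝ := Matrix.of fun i j =>
    MvPolynomial.eval (fun j => (0 : E d) j) (MvPolynomial.pderiv j (p i))
  refine ⟨v 0, η, ?_, fun x i => ?_⟩
  · ext i j
    simp only [η, Matrix.transpose_apply, Matrix.of_apply, Matrix.neg_apply]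
    rw [hanti j i, map_neg]
  · let q := p i - ∑ j, MvPolynomial.C (η i j) * MvPolynomial.X j
    have hq : ∀ (x : E d) l,
        MvPolynomial.eval (fun j => x j) (MvPolynomial.pderiv l q) = 0 := by
      intro x l
      simp only [q, map_sub, map_sum, Derivation.leibniz, MvPolynomial.pderiv_X,
        MvPolynomial.pderiv_C, hgrad i l x]
      simp [η, Pi.single_apply, apply_ite]
    have := eval_eq_eval_zero_of_pderiv hq x
    simp only [q, map_sub, map_sum, map_mul, MvPolynomial.eval_C, MvPolynomial.eval_X,
      ← hp] at this
    simp at this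
    linarith

/-- The strain as a linear map on polynomial fields. -/
def strainMap (d k : ℕ) : polyField d k →ₗ[ℝ] (E d → Fin d → Fin d → ℝ) where
  toFun v := strain v.1
  map_add' v w := by
    ext x i j
    have hv := polyField_differentiable v.2
    have hw := polyField_differentiable w.2
    simp only [strain, Submodule.coe_add, Pi.add_apply, fderiv_add (hv x) (hw x)]
    simp only [add_apply, PiLp.add_apply]
    ring
  map_smul' c v := by
    ext x i j
    have hv := polyField_differentiable v.2
    simp only [strain, Submodule.coe_smul, Pi.smul_apply, fderiv_const_smul (hv x)]
    simp only [smul_apply, PiLp.smul_apply, smul_eq_mul, RingHom.id_apply]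
    ring

theorem strainMap_apply {d k : ℕ} (v : polyField d k) : strainMap d k v = strain v.1 := rfl

theorem strainNormSq_nonneg {d : ℕ} (v : E d → E d) (T : Set (E d)) : 0 ≤ strainNormSq v T :=
  integral_nonneg fun x => by positivity

/-- Applied with `R` the kernel of the strain map: the vectors `a` are coordinates on the fields
modulo strain-free ones, and `a ≠ 0` forces a nonzero strain. -/
theorem exists_complement_family {V : Type*} [AddCommGroup V] [Module ℝ V] [FiniteDimensional ℝ V]
    (R : Submodule ℝ V) : ∃ (n : ℕ) (b : Fin n → V),
      (∀ v, ∃ a : Fin n → ℝ, v - ∑ m, a m • b m ∈ R) ∧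
      ∀ a : Fin n → ℝ, ∑ m, a m • b m ∈ R → a = 0 := by
  obtain ⟨W, hW⟩ := Submodule.exists_isCompl R
  let b := Module.finBasis ℝ W
  have hsum : ∀ a : Fin _ → ℝ, ∑ m, a m • (b m : V) = (b.equivFun.symm a : W) := fun a => by
    simp [b.equivFun_symm_apply]
  refine ⟨_, fun m => b m, fun v => ?_, fun a ha => ?_⟩
  · obtain ⟨r, hr, w, hw, hrw⟩ := Submodule.mem_sup.1
      (hW.sup_eq_top ▸ Submodule.mem_top : v ∈ R ⊔ W)
    refine ⟨b.equivFun ⟨w, hw⟩, ?_⟩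
    rw [hsum, LinearEquiv.symm_apply_apply, ← hrw]
    simpa using hr
  · rw [hsum] at ha
    have h1 : b.equivFun.symm a = 0 :=
      Subtype.ext (Submodule.disjoint_def.1 hW.disjoint _ ha (b.equivFun.symm a).2)
    exact (LinearEquiv.map_eq_zero_iff _).1 h1

/-- Discarding the sublevel set costs less than half of the guaranteed measure `ρ`; on what is left
of `K`, `f ≥ δ`, and Markov's inequality applies. -/
theorem le_setIntegral_of_measure_sublevel_lt {n : ℕ} {B K : Set (E n)} (hB : IsCompact B)
    (hK : K ⊆ B) {ρ δ : ℝ} (hρ : 0 ≤ ρ) (hKρ : ρ ≤ volume.real K) {f : E n → ℝ}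
    (hf : Continuous f) (hf0 : ∀ x, 0 ≤ f x)
    (hsub : volume {x ∈ B | |f x| ≤ δ} < ENNReal.ofReal (ρ / 2)) :
    δ * (ρ / 2) ≤ ∫ x in K, f x := by
  rcases le_or_gt δ 0 with hδ | hδ
  · exact (mul_nonpos_of_nonpos_of_nonneg hδ (by positivity)).trans
      (integral_nonneg fun x => hf0 x)
  have hi : IntegrableOn f K := (hf.continuousOn.integrableOn_compact hB).mono_set hK
  refine le_trans ?_ (mul_meas_ge_le_integral_of_nonneg (Eventually.of_forall hf0) hi δ)
  refine mul_le_mul_of_nonneg_left ?_ hδ.le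
  have hfin : volume K < ⊤ := (measure_mono hK).trans_lt hB.measure_lt_top
  have hms : MeasurableSet {x | δ ≤ f x} := (isClosed_le continuous_const hf).measurableSet
  rw [measureReal_restrict_apply hms]
  have h1 : volume.real {x ∈ B | |f x| ≤ δ} ≤ ρ / 2 :=
    ENNReal.toReal_le_of_le_ofReal (by positivity) hsub.le
  have h3 : volume ({x | δ ≤ f x} ∩ K) < ⊤ := (measure_mono inter_subset_right).trans_lt hfin
  have h4 : volume {x ∈ B | |f x| ≤ δ} < ⊤ := hsub.trans ENNReal.ofReal_lt_top
  have h2 : volume.real K ≤ volume.real ({x | δ ≤ f x} ∩ K) +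
      volume.real {x ∈ B | |f x| ≤ δ} := by
    refine (measureReal_mono ?_ (measure_union_lt_top h3 h4).ne).trans (measureReal_union_le _ _)
    intro x hx
    rcases le_total δ (f x) with h | h
    · exact Or.inl ⟨h, hx⟩
    · exact Or.inr ⟨hK hx, by rwa [abs_of_nonneg (hf0 _)]⟩
  linarith

/-- On subsets of the unit ball whose measure is bounded below, a polynomial field is close to a
rigid motion, uniformly on the ball, as measured by its strain on the subset. -/
theorem exists_rigidMotion_sub_le (d k : ℕ) {ρ : ℝ} (hρ : 0 < ρ) :
    ∃ C : ℝ, 0 ≤ C ∧ ∀ v ∈ polyField d k, ∀ K ⊆ Metric.closedBall (0 : E d) 1,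
      ρ ≤ volume.real K → ∃ r ∈ rigidMotion d, ∀ x ∈ Metric.closedBall (0 : E d) 1,
        ‖v x - r x‖ ^ 2 ≤ C * strainNormSq v K := by
  obtain ⟨n, b, hspan, hindep⟩ := exists_complement_family (LinearMap.ker (strainMap d k))
  let g : (Fin n → ℝ) →ₗ[ℝ] polyField d k := Fintype.linearCombination ℝ b
  have hg : ∀ a, g a = ∑ m, a m • b m := fun a => Fintype.linearCombination_apply ℝ b a
  obtain ⟨F, hF⟩ : ∃ F : (Fin n → ℝ) → E d → ℝ,
      ∀ a x, F a x = ∑ i, ∑ j, strainMap d k (g a) x i j ^ 2 := ⟨_, fun _ _ => rfl⟩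
  have hg1 : ∀ a x, (g a).1 x = ∑ m, a m • (b m).1 x := fun a x => by
    rw [hg]
    simp [Finset.sum_apply]
  have hcw : Continuous fun q : (Fin n → ℝ) × E d => (g q.1).1 q.2 := by
    simp_rw [hg1]
    have : ∀ m, Continuous (b m).1 := fun m =>
      polyField_continuous (b m).2
    fun_prop
  have hcF : Continuous fun q : (Fin n → ℝ) × E d => F q.1 q.2 := by
    simp only [hF, hg, map_sum, map_smul, Finset.sum_apply, Pi.smul_apply, smul_eq_mul,
      strainMap_apply]
    have : ∀ m i j, Continuous fun x => strain (b m).1 x i j := fun m =>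
      strain_continuous (b m).2
    fun_prop
  have hF0 : ∀ a x, 0 ≤ F a x := fun a x => by rw [hF]; positivity
  let S : Set (Fin n → ℝ) := Metric.sphere 0 1
  have hB := isCompact_closedBall (0 : E d) 1
  have hzero : ∀ a ∈ S, volume {x ∈ Metric.closedBall (0 : E d) 1 | F a x = 0} = 0 := by
    intro a ha
    have hex : ∃ y i j, strain (g a).1 y i j ≠ 0 := by
      by_contra! hcon
      have hker : g a ∈ LinearMap.ker (strainMap d k) := by
        rw [LinearMap.mem_ker]
        ext x i j
        exact hcon x i j
      have h2 : a = 0 := hindep a (hg a ▸ hker)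
      simp [S, h2] at ha
    obtain ⟨y, i, j, hy⟩ := hex
    obtain ⟨q, hq⟩ := strain_eq_eval (g a).2 i j
    rw [hq] at hy
    refine measure_mono_null ?_ (volume_zero_set_eval hy)
    rintro x ⟨-, hx⟩
    rw [hF] at hx
    have h1 := (Finset.sum_eq_zero_iff_of_nonneg fun i _ => by positivity).1 hx i (by simp)
    have h2 := (Finset.sum_eq_zero_iff_of_nonneg fun i _ => by positivity).1 h1 j (by simp)
    rw [strainMap_apply, hq] at h2
    exact pow_eq_zero_iff two_ne_zero |>.1 h2
  -- The compactness is in the coefficients only, so `δ` is the same for all sets `K`.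
  obtain ⟨δ, hδ, hsub⟩ := exists_measure_sublevel_lt (isCompact_sphere (0 : Fin n → ℝ) 1) hB hcF
    hzero (c := ENNReal.ofReal (ρ / 2)) (by simpa using hρ)
  obtain ⟨M, hM⟩ := ((isCompact_sphere (0 : Fin n → ℝ) 1).prod hB).exists_bound_of_continuousOn
    hcw.continuousOn
  -- For coefficients of norm one, the field is at most `M` on the ball and its squared strain norm
  -- on `K` is at least `δρ/2`. Both squared quantities scale by `‖a‖²`.
  refine ⟨M ^ 2 * (2 / (δ * ρ)), by positivity, fun v hv K hK hKρ => ?_⟩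
  obtain ⟨a, ha⟩ := hspan ⟨v, hv⟩
  rw [← hg] at ha
  have hrRM : v - (g a).1 ∈ rigidMotion d :=
    mem_rigidMotion_of_strain_eq_zero ((⟨v, hv⟩ : polyField d k) - g a).2 fun x i j =>
      congrFun (congrFun (congrFun (LinearMap.mem_ker.1 ha) x) i) j
  refine ⟨_, hrRM, fun x hx => ?_⟩
  have hstrain : strainNormSq v K = ∫ x in K, F a x := by
    have : strain v = strainMap d k (g a) := by
      have := LinearMap.mem_ker.1 ha
      rwa [map_sub, sub_eq_zero] at this
    simp only [strainNormSq, this, hF]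
  rw [Pi.sub_apply, sub_sub_cancel]
  by_cases ha : a = 0
  · rw [ha, map_zero]
    simpa using mul_nonneg (by positivity) (strainNormSq_nonneg v K)
  have hna : 0 < ‖a‖ := norm_pos_iff.2 ha
  obtain ⟨a', ha', haa⟩ : ∃ a' ∈ S, a = ‖a‖ • a' :=
    ⟨‖a‖⁻¹ • a, by simp [S, norm_smul, hna.ne'], by simp [smul_smul, hna.ne']⟩
  have hga : g a = ‖a‖ • g a' := by
    conv_lhs => rw [haa, map_smul]
  have hFa : ∀ x, F a x = ‖a‖ ^ 2 * F a' x := fun x => by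
    have h : strainMap d k (g a) = ‖a‖ • strainMap d k (g a') := by rw [hga, map_smul]
    simp only [hF, h, Pi.smul_apply, smul_eq_mul, mul_pow, Finset.mul_sum]
  have hint : δ * (ρ / 2) ≤ ∫ x in K, F a' x := by
    have hcF' : Continuous (F a') := hcF.comp (by fun_prop : Continuous fun x : E d => (a', x))
    exact le_setIntegral_of_measure_sublevel_lt hB hK hρ.le hKρ hcF' (hF0 a') (hsub a' ha')
  have hbound : ‖(g a).1 x‖ ≤ ‖a‖ * M := by
    have : (g a).1 x = ‖a‖ • (g a').1 x := by
      rw [hga]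
      rfl
    rw [this, norm_smul, norm_norm]
    gcongr
    exact hM (a', x) ⟨ha', hx⟩
  rw [hstrain]
  simp_rw [hFa]
  rw [integral_const_mul]
  calc ‖(g a).1 x‖ ^ 2 ≤ (‖a‖ * M) ^ 2 := by gcongr
    _ = M ^ 2 * (2 / (δ * ρ)) * (‖a‖ ^ 2 * (δ * (ρ / 2))) := by field_simp
    _ ≤ _ := by gcongr

/-! ### Flat sets of positive measure are not thin -/

/-- A nonzero affine function vanishes on a null set only, so for coefficients of norm one its
`δ`-sublevel sets in the ball are uniformly too small to contain `K`; homogeneity gives the general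
case. -/
theorem exists_le_abs_inner_add (m : ℕ) (R : ℝ) {c : ENNReal} (hc : 0 < c) :
    ∃ δ : ℝ, 0 < δ ∧ ∀ K ⊆ Metric.closedBall (0 : E m) R, c ≤ volume K →
      ∀ q : E m × ℝ, ∃ y ∈ K, δ * ‖q‖ ≤ |inner ℝ q.1 y + q.2| := by
  have hB := isCompact_closedBall (0 : E m) R
  have hzero : ∀ q ∈ Metric.sphere (0 : E m × ℝ) 1,
      volume {x ∈ Metric.closedBall (0 : E m) R | inner ℝ q.1 x + q.2 = 0} = 0 := by
    intro q hq
    have hex : ∃ y : E m, inner ℝ q.1 y + q.2 ≠ 0 := by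
      by_contra! h
      have h2 : q.2 = 0 := by simpa using h 0
      have h1 : q.1 = 0 := by simpa [h2] using h q.1
      rw [show q = 0 from Prod.ext h1 h2] at hq
      simp at hq
    obtain ⟨y, hy⟩ := hex
    have hcl : IsClosed {x : E m | inner ℝ q.1 x + q.2 = 0} :=
      isClosed_eq (by fun_prop) continuous_const
    refine measure_mono_null (fun x hx => hx.2) (volume_eq_zero_of_countable_lines hcl y fun x => ?_)
    refine Set.Subsingleton.countable fun t ht t' ht' => ?_
    have ht : inner ℝ q.1 (y + t • x) + q.2 = 0 := ht
    have ht' : inner ℝ q.1 (y + t' • x) + q.2 = 0 := ht'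
    rw [inner_add_right, inner_smul_right] at ht ht'
    have hx : inner ℝ q.1 x ≠ 0 := by
      intro h0
      rw [h0] at ht
      apply hy
      linarith
    exact mul_right_cancel₀ hx (by linarith)
  obtain ⟨δ, hδ, h⟩ := exists_measure_sublevel_lt (isCompact_sphere (0 : E m × ℝ) 1) hB
    (F := fun q x => inner ℝ q.1 x + q.2) (by fun_prop) hzero hc
  refine ⟨δ, hδ, fun K hK hcK q => ?_⟩
  by_cases hq : q = 0
  · obtain ⟨y, hy⟩ : K.Nonempty := nonempty_of_measure_ne_zero (hc.trans_le hcK).ne'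
    exact ⟨y, hy, by simp [hq]⟩
  have hn : 0 < ‖q‖ := norm_pos_iff.2 hq
  have hs : ‖q‖⁻¹ • q ∈ Metric.sphere (0 : E m × ℝ) 1 := by simp [norm_smul, hn.ne']
  by_contra! hcon
  refine (h _ hs).not_ge (hcK.trans (measure_mono fun y hy => ⟨hK hy, ?_⟩))
  have h1 : inner ℝ (‖q‖⁻¹ • q).1 y + (‖q‖⁻¹ • q).2 = ‖q‖⁻¹ * (inner ℝ q.1 y + q.2) := by
    simp [inner_smul_left, mul_add]
  change |_| ≤ δ
  rw [h1, abs_mul, abs_of_pos (inv_pos.2 hn), inv_mul_le_iff₀ hn, mul_comm]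
  exact (hcon y hy).le

/-- Euclidean coordinates on the hyperplane `n^⊥`, in which surface measure on a flat side becomes
Lebesgue measure on `ℝ^m`. -/
theorem exists_isometry_orthogonal {m : ℕ} {n : E (m + 1)} (hn : ‖n‖ = 1) :
    ∃ L : E m →ₗᵢ[ℝ] E (m + 1), (∀ y, inner ℝ n (L y) = 0) ∧
      ∀ z, inner ℝ n z = 0 → ∃ y, L y = z := by
  have : Fact (Module.finrank ℝ (E (m + 1)) = m + 1) := ⟨by simp⟩
  have hn0 : n ≠ 0 := by
    rintro rfl
    simp at hn
  let b := OrthonormalBasis.fromOrthogonalSpanSingleton (𝕜 := ℝ) m hn0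
  refine ⟨(Submodule.subtypeₗᵢ _).comp b.repr.symm.toLinearIsometry, fun y => ?_, fun z hz => ?_⟩
  · exact Submodule.mem_orthogonal_singleton_iff_inner_right.1 (b.repr.symm y).2
  · refine ⟨b.repr ⟨z, Submodule.mem_orthogonal_singleton_iff_inner_right.2 hz⟩, ?_⟩
    simp

theorem isometry_const_add {m n : ℕ} (x : E n) (L : E m →ₗᵢ[ℝ] E n) :
    Isometry fun y => x + L y :=
  (IsometryEquiv.addLeft x).isometry.comp L.isometry

/-- A flat set is the isometric image of a set in `ℝ^m`. -/
theorem exists_param_of_flat {m : ℕ} {e : Set (E (m + 1))} {n x₀ : E (m + 1)} {s : ℝ}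
    (he : ∀ x ∈ e, inner ℝ n x = s) (hx₀ : inner ℝ n x₀ = s) {L : E m →ₗᵢ[ℝ] E (m + 1)}
    (hL : ∀ z, inner ℝ n z = 0 → ∃ y, L y = z) :
    μHE[m] e = volume {y | x₀ + L y ∈ e} := by
  rw [← EuclideanSpace.euclideanHausdorffMeasure_eq_volume,
    ← (isometry_const_add x₀ L).euclideanHausdorffMeasure_image]
  congr 1
  ext x
  refine ⟨fun hx => ?_, ?_⟩
  · obtain ⟨y, hy⟩ := hL (x - x₀) (by rw [inner_sub_right, he x hx, hx₀, sub_self])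
    have hxy : x₀ + L y = x := by rw [hy, add_sub_cancel]
    exact ⟨y, by simpa [hxy] using hx, hxy⟩
  · rintro ⟨y, hy, rfl⟩
    exact hy

/-- The surface measure of a flat subset of the unit ball is bounded. -/
theorem measure_flat_le {m : ℕ} {e : Set (E (m + 1))} (hB : e ⊆ Metric.closedBall 0 1)
    {n : E (m + 1)} (hn : ‖n‖ = 1) {s : ℝ} (he : ∀ x ∈ e, inner ℝ n x = s) :
    μHE[m] e ≤ volume (Metric.closedBall (0 : E m) 2) := by
  rcases e.eq_empty_or_nonempty with rfl | ⟨x₀, hx₀⟩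
  · simp
  obtain ⟨L, -, hL⟩ := exists_isometry_orthogonal hn
  rw [exists_param_of_flat he (he x₀ hx₀) hL]
  refine measure_mono fun y hy => ?_
  have h1 := mem_closedBall_zero_iff.1 (hB hy)
  have h2 := mem_closedBall_zero_iff.1 (hB hx₀)
  rw [mem_closedBall_zero_iff, ← L.norm_map, show L y = (x₀ + L y) - x₀ by abel]
  exact (norm_sub_le _ _).trans (by linarith)

/-- Seen from an apex at height at least `σ`, a flat set of measure at least `c` is not close to
any hyperplane through the apex. -/
theorem exists_le_abs_inner_sub_apex (m : ℕ) {c : ENNReal} (hc : 0 < c) {σ : ℝ} (hσ : 0 < σ) :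
    ∃ δ : ℝ, 0 < δ ∧ ∀ (e : Set (E (m + 1))) (A n : E (m + 1)) (s : ℝ),
      e ⊆ Metric.closedBall 0 1 → A ∈ Metric.closedBall (0 : E (m + 1)) 1 → ‖n‖ = 1 →
      (∀ x ∈ e, inner ℝ n x = s) → σ ≤ s - inner ℝ n A → c ≤ μHE[m] e →
      ∀ w, ∃ x ∈ e, δ * ‖w‖ ≤ |inner ℝ w (x - A)| := by
  obtain ⟨δ, hδ, h⟩ := exists_le_abs_inner_add m 2 hc
  -- On the plane of `e`, `x ↦ ⟪w, x - A⟫` is the affine function `y ↦ ⟪w', y⟫ + b`, with `w'` the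
  -- tangential part of `w`. The height bound recovers the normal part `β` from `b = βH + ⟪w', z⟫`:
  -- since `‖z‖ ≤ 4` and `H ≥ σ`, `|β| ≤ 5N/σ` with `N = ‖(w', b)‖`, and so `‖w‖ ≤ (5/σ + 1)N`.
  refine ⟨δ / (5 / σ + 1), by positivity, fun e A n s heB hA hn he hs hce w => ?_⟩
  obtain ⟨x₀, hx₀⟩ : e.Nonempty := nonempty_of_measure_ne_zero (hc.trans_le hce).ne'
  obtain ⟨L, hL0, hL⟩ := exists_isometry_orthogonal hn
  rw [exists_param_of_flat he (he x₀ hx₀) hL] at hce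
  have hnn : inner ℝ n n = 1 := by rw [real_inner_self_eq_norm_sq, hn, one_pow]
  set H := s - inner ℝ n A with hH
  have hx₀A : inner ℝ n (x₀ - A) = H := by rw [inner_sub_right, he x₀ hx₀]
  have hxA : ‖x₀ - A‖ ≤ 2 := by
    have h1 := mem_closedBall_zero_iff.1 (heB hx₀)
    have h2 := mem_closedBall_zero_iff.1 hA
    exact (norm_sub_le _ _).trans (by linarith)
  have hH2 : H ≤ 2 := by
    rw [← hx₀A]
    exact (real_inner_le_norm _ _).trans (by rw [hn, one_mul]; exact hxA)
  obtain ⟨z, hz⟩ := hL (x₀ - A - H • n) (by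
    rw [inner_sub_right, inner_smul_right, hx₀A, hnn, mul_one, sub_self])
  obtain ⟨w', hw'⟩ := hL (w - (inner ℝ n w : ℝ) • n) (by
    rw [inner_sub_right, inner_smul_right, hnn, mul_one, sub_self])
  set β : ℝ := inner ℝ n w
  have hxA' : x₀ - A = H • n + L z := by rw [hz]; abel
  have hw : w = β • n + L w' := by rw [hw']; abel
  have hLn : ∀ y, inner ℝ (L y) n = 0 := fun y => by rw [real_inner_comm, hL0]
  set b : ℝ := inner ℝ w (x₀ - A) with hb
  have hb' : b = β * H + inner ℝ w' z := by
    rw [hb, hxA', hw]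
    simp only [inner_add_left, inner_add_right, inner_smul_left, inner_smul_right, hnn, hL0, hLn,
      L.inner_map_map]
    simp
    ring
  have hwy : ∀ y, inner ℝ w (x₀ + L y - A) = inner ℝ w' y + b := fun y => by
    rw [show x₀ + L y - A = L y + (x₀ - A) by abel, inner_add_right, ← hb]
    congr 1
    rw [hw]
    simp only [inner_add_left, inner_smul_left, hL0, L.inner_map_map]
    simp
  obtain ⟨y, hy, hyb⟩ := h {y | x₀ + L y ∈ e} (fun y hy => by
    have h1 := mem_closedBall_zero_iff.1 (heB hy)
    have h2 := mem_closedBall_zero_iff.1 (heB hx₀)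
    rw [mem_closedBall_zero_iff, ← L.norm_map, show L y = (x₀ + L y) - x₀ by abel]
    exact (norm_sub_le _ _).trans (by linarith)) hce (w', b)
  refine ⟨x₀ + L y, hy, ?_⟩
  rw [hwy]
  refine le_trans ?_ hyb
  set N := ‖(w', b)‖
  have hN1 : ‖w'‖ ≤ N := norm_fst_le (w', b)
  have hN2 : |b| ≤ N := norm_snd_le (w', b)
  have hz4 : ‖z‖ ≤ 4 := by
    rw [← L.norm_map, hz]
    refine (norm_sub_le _ _).trans ?_
    rw [norm_smul, hn, mul_one, Real.norm_of_nonneg (hσ.le.trans hs)]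
    linarith
  have hβ : |β| * σ ≤ 5 * N := by
    calc |β| * σ ≤ |β| * H := by gcongr
      _ = |b - inner ℝ w' z| := by
        rw [hb', add_sub_cancel_right, abs_mul, abs_of_nonneg (hσ.le.trans hs)]
      _ ≤ |b| + ‖w'‖ * ‖z‖ := (abs_sub _ _).trans (by gcongr; exact abs_real_inner_le_norm _ _)
      _ ≤ N + N * 4 := by gcongr
      _ = 5 * N := by ring
  have hwN : ‖w‖ ≤ (5 / σ + 1) * N := by
    calc ‖w‖ ≤ ‖β • n‖ + ‖L w'‖ := by
          conv_lhs => rw [hw]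
          exact norm_add_le _ _
      _ = |β| + ‖w'‖ := by rw [norm_smul, hn, mul_one, L.norm_map, Real.norm_eq_abs]
      _ ≤ 5 * N / σ + N := by
        gcongr
        rwa [le_div_iff₀ hσ]
      _ = _ := by ring
  rw [div_mul_eq_mul_div, div_le_iff₀ (by positivity)]
  calc δ * ‖w‖ ≤ δ * ((5 / σ + 1) * N) := by gcongr
    _ = _ := by ring

/-! ### Frames with large determinant -/

/-- The matrix whose columns are the given vectors. -/
def frameMatrix {d : ℕ} (q : Fin d → E d) : Matrix (Fin d) (Fin d) ℝ := Matrix.of fun i j => q j i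

/-- Among the points of a set that is not close to any hyperplane through the origin there are
`d` points with large determinant. -/
theorem exists_det_frameMatrix_ge {d : ℕ} {K : Set (E d)} {δ : ℝ} (hδ : 0 ≤ δ)
    (h : ∀ w, ∃ x ∈ K, δ * ‖w‖ ≤ |inner ℝ w x|) :
    ∃ q : Fin d → E d, (∀ i, q i ∈ K) ∧ δ ^ d ≤ |(frameMatrix q).det| := by
  -- The standard basis vectors are exchanged for points of `K` one at a time, each exchange costing
  -- at most a factor `δ` in the determinant.
  have key : ∀ l ≤ d, ∃ q : Fin d → E d, (∀ i, i.1 < l → q i ∈ K) ∧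
      (∀ i, l ≤ i.1 → q i = EuclideanSpace.single i 1) ∧ δ ^ l ≤ |(frameMatrix q).det| := by
    intro l
    induction l with
    | zero =>
      refine fun _ => ⟨fun j => EuclideanSpace.single j 1, by simp, by simp, ?_⟩
      have : frameMatrix (fun j : Fin d => EuclideanSpace.single j (1 : ℝ)) = 1 := by
        ext i j
        simp [frameMatrix, Matrix.one_apply]
      simp [this]
    | succ l ih =>
      intro hl
      obtain ⟨q, hqK, hqe, hq⟩ := ih (by omega)
      let j : Fin d := ⟨l, hl⟩
      -- The determinant is linear in column `j`, and the cofactors of that column represent it as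
      -- `x ↦ ⟪w, x⟫`. The present column is a unit vector, so `‖w‖` is at least the present
      -- determinant.
      let w : E d := WithLp.toLp 2 fun i => (frameMatrix q).adjugate j i
      have hw : ∀ x, inner ℝ w x = (frameMatrix (Function.update q j x)).det := by
        intro x
        have h1 : frameMatrix (Function.update q j x) =
            (frameMatrix q).updateCol j x.ofLp := by
          ext a b
          rw [Matrix.updateCol_apply]
          by_cases hb : b = j <;> simp [frameMatrix, hb]
        rw [h1, ← Matrix.cramer_apply, Matrix.cramer_eq_adjugate_mulVec, Matrix.mulVec,
          dotProduct, PiLp.inner_apply]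
        simp [w, mul_comm]
      obtain ⟨x, hx, hxw⟩ := h w
      refine ⟨Function.update q j x, fun i hi => ?_, fun i hi => ?_, ?_⟩
      · by_cases hij : i = j
        · simpa [hij] using hx
        · have : i.1 ≠ l := fun h => hij (Fin.ext h)
          simpa [hij] using hqK i (by omega)
      · have hij : i ≠ j := fun h => by
          rw [h] at hi
          exact absurd hi (by simp [j])
        simpa [hij] using hqe i (by omega)
      · rw [← hw]
        refine le_trans ?_ hxw
        have h2 : |(frameMatrix q).det| ≤ ‖w‖ := by
          have h3 : Function.update q j (EuclideanSpace.single j 1) = q := by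
            rw [← hqe j le_rfl, Function.update_eq_self]
          have h4 := hw (EuclideanSpace.single j 1)
          rw [h3] at h4
          rw [← h4]
          exact (abs_real_inner_le_norm _ _).trans (by simp)
        rw [pow_succ, mul_comm]
        gcongr
        exact hq.trans h2
  obtain ⟨q, hq, -, hdet⟩ := key d le_rfl
  exact ⟨q, fun i => hq i i.2, hdet⟩

/-! ### Coordinates with respect to a simplex with apex -/

/-- The matrix of the edge vectors of the simplex with apex `q.1` and base vertices `q.2`. -/
def edgeMatrix {d : ℕ} (q : E d × (Fin d → E d)) : Matrix (Fin d) (Fin d) ℝ :=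
  frameMatrix fun i => q.2 i - q.1

/-- The barycentric coordinates of `y` belonging to the base vertices. -/
def baseCoord {d : ℕ} (q : E d × (Fin d → E d)) (y : E d) : Fin d → ℝ :=
  (edgeMatrix q)⁻¹.mulVec (y - q.1).ofLp

/-- The barycentric coordinate of `y` belonging to the apex. -/
def apexCoord {d : ℕ} (q : E d × (Fin d → E d)) (y : E d) : ℝ := 1 - ∑ i, baseCoord q y i

section Simplex

variable {d : ℕ} {q : E d × (Fin d → E d)}

theorem edgeMatrix_mulVec (q : E d × (Fin d → E d)) (c : Fin d → ℝ) :
    (edgeMatrix q).mulVec c = (∑ i, c i • (q.2 i - q.1)).ofLp := by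
  ext i
  simp [edgeMatrix, frameMatrix, Matrix.mulVec, dotProduct, mul_comm]

theorem baseCoord_add_sum (hq : (edgeMatrix q).det ≠ 0) (c : Fin d → ℝ) :
    baseCoord q (q.1 + ∑ i, c i • (q.2 i - q.1)) = c := by
  rw [baseCoord, add_sub_cancel_left, ← edgeMatrix_mulVec, Matrix.mulVec_mulVec,
    Matrix.nonsing_inv_mul _ (isUnit_iff_ne_zero.2 hq), Matrix.one_mulVec]

theorem add_sum_baseCoord (hq : (edgeMatrix q).det ≠ 0) (y : E d) :
    q.1 + ∑ i, baseCoord q y i • (q.2 i - q.1) = y := by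
  have h : (∑ i, baseCoord q y i • (q.2 i - q.1)).ofLp = (y - q.1).ofLp := by
    rw [← edgeMatrix_mulVec, baseCoord, Matrix.mulVec_mulVec,
      Matrix.mul_nonsing_inv _ (isUnit_iff_ne_zero.2 hq), Matrix.one_mulVec]
  rw [WithLp.ofLp_injective 2 h, add_sub_cancel]

theorem sum_baseCoord_add_apexCoord (hq : (edgeMatrix q).det ≠ 0) (y : E d) :
    ∑ i, baseCoord q y i • q.2 i + apexCoord q y • q.1 = y := by
  conv_rhs => rw [← add_sum_baseCoord hq y]
  simp only [apexCoord, smul_sub, Finset.sum_sub_distrib, sub_smul, Finset.sum_smul, one_smul]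
  abel

theorem baseCoord_lineMap (q : E d × (Fin d → E d)) (y z : E d) (t : ℝ) :
    baseCoord q (y + t • (z - y)) = fun i => (1 - t) * baseCoord q y i + t * baseCoord q z i := by
  have h : (y + t • (z - y) - q.1).ofLp = (1 - t) • (y - q.1).ofLp + t • (z - q.1).ofLp := by
    ext i
    simp
    ring
  ext i
  rw [baseCoord, h, Matrix.mulVec_add, Matrix.mulVec_smul, Matrix.mulVec_smul]
  rfl

theorem apexCoord_lineMap (q : E d × (Fin d → E d)) (y z : E d) (t : ℝ) :
    apexCoord q (y + t • (z - y)) = (1 - t) * apexCoord q y + t * apexCoord q z := by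
  simp only [apexCoord, baseCoord_lineMap, Finset.sum_add_distrib, ← Finset.mul_sum]
  ring

theorem continuous_edgeMatrix :
    Continuous (edgeMatrix : E d × (Fin d → E d) → Matrix (Fin d) (Fin d) ℝ) := by
  refine continuous_matrix fun i j => ?_
  change Continuous fun q : E d × (Fin d → E d) => (q.2 j - q.1) i
  fun_prop

/-- Joint continuity in the simplex and the point, from writing the inverse matrix as adjugate over
determinant; it is what makes the picture stable under perturbation of the simplex. -/
theorem continuousAt_baseCoord (hq : (edgeMatrix q).det ≠ 0) (y : E d) :
    ContinuousAt (fun r : (E d × (Fin d → E d)) × E d => baseCoord r.1 r.2) (q, y) := by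
  simp only [baseCoord, Matrix.inv_def, Ring.inverse_eq_inv', Matrix.smul_mulVec]
  have h1 : Continuous fun r : (E d × (Fin d → E d)) × E d => edgeMatrix r.1 :=
    continuous_edgeMatrix.comp continuous_fst
  refine ContinuousAt.smul (ContinuousAt.inv₀ h1.matrix_det.continuousAt hq) ?_
  refine (Continuous.matrix_mulVec h1.matrix_adjugate ?_).continuousAt
  exact (PiLp.continuous_ofLp 2 _).comp (by fun_prop)

theorem continuousAt_apexCoord (hq : (edgeMatrix q).det ≠ 0) (y : E d) :
    ContinuousAt (fun r : (E d × (Fin d → E d)) × E d => apexCoord r.1 r.2) (q, y) := by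
  have h := continuousAt_baseCoord hq y
  simp only [apexCoord]
  exact continuousAt_const.sub (tendsto_finsetSum _ fun i _ => (continuousAt_pi.1 h) i)

theorem continuous_baseCoord (q : E d × (Fin d → E d)) : Continuous (baseCoord q) :=
  Continuous.matrix_mulVec continuous_const
    ((PiLp.continuous_ofLp 2 _).comp (continuous_id.sub continuous_const))

theorem continuous_apexCoord (q : E d × (Fin d → E d)) : Continuous (apexCoord q) :=
  continuous_const.sub (continuous_finsetSum _ fun i _ =>
    (continuous_apply i).comp (continuous_baseCoord q))

/-- The barycenter of the base. -/
def baseCenter (q : E d × (Fin d → E d)) : E d := (d : ℝ)⁻¹ • ∑ i, q.2 i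

theorem baseCenter_eq (hd : d ≠ 0) (q : E d × (Fin d → E d)) :
    baseCenter q = q.1 + ∑ i, (d : ℝ)⁻¹ • (q.2 i - q.1) := by
  have : (d : ℝ) ≠ 0 := by exact_mod_cast hd
  simp [baseCenter, smul_sub, Finset.sum_sub_distrib, Finset.smul_sum, ← Nat.cast_smul_eq_nsmul ℝ,
    smul_smul, this]

/-- Simplices near a given nondegenerate one look alike in a fixed ball about the barycenter of its
base. -/
theorem eventually_simplex_like (hd : d ≠ 0) (hq : (edgeMatrix q).det ≠ 0) :
    ∃ (g a : E d) (R : ℝ), a ∈ Metric.ball g R ∧ ∀ᶠ r in 𝓝 q,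
      (edgeMatrix r).det ≠ 0 ∧ (∀ y ∈ Metric.ball g R, ∀ i, 0 < baseCoord r y i) ∧
      0 < apexCoord r a ∧ baseCenter r ∈ Metric.ball g R := by
  have hd' : (0 : ℝ) < d := by exact_mod_cast Nat.pos_of_ne_zero hd
  -- At the barycenter of the base all base coordinates equal `1/d > 0`, so they stay positive
  -- nearby, for nearby simplices as well. The point `a` is found by moving slightly towards the
  -- apex, where the apex coordinate becomes positive.
  have hbase : baseCoord q (baseCenter q) = fun _ => (d : ℝ)⁻¹ := by
    rw [baseCenter_eq hd, baseCoord_add_sum hq fun _ => (d : ℝ)⁻¹]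
  have hapex : apexCoord q (baseCenter q) = 0 := by
    simp [apexCoord, hbase, hd'.ne']
  have hapex1 : apexCoord q q.1 = 1 := by
    simp [apexCoord, baseCoord]
  have h1 : ∀ᶠ r in 𝓝 (q, baseCenter q), ∀ i, 0 < baseCoord r.1 r.2 i := by
    refine eventually_all.2 fun i => ?_
    refine (continuousAt_pi.1 (continuousAt_baseCoord hq (baseCenter q)) i).eventually_const_lt ?_
    simpa [hbase] using hd'
  rw [nhds_prod_eq] at h1
  obtain ⟨p₁, hp₁, p₂, hp₂, h12⟩ := eventually_prod_iff.1 h1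
  obtain ⟨R, hR, hball⟩ := Metric.eventually_nhds_iff_ball.1 hp₂
  have hc : Continuous fun t : ℝ => baseCenter q + t • (q.1 - baseCenter q) := by fun_prop
  have hev : ∀ᶠ t : ℝ in 𝓝[>] 0, baseCenter q + t • (q.1 - baseCenter q) ∈
      Metric.ball (baseCenter q) R := by
    refine mem_nhdsWithin_of_mem_nhds (hc.continuousAt.preimage_mem_nhds ?_)
    simpa using Metric.ball_mem_nhds _ hR
  obtain ⟨t, ht, ht0⟩ := (hev.and self_mem_nhdsWithin).exists
  have ht0 : 0 < t := ht0
  refine ⟨baseCenter q, _, R, ht, ?_⟩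
  have hdet : ∀ᶠ r in 𝓝 q, (edgeMatrix r).det ≠ 0 :=
    (continuous_edgeMatrix.matrix_det.continuousAt).eventually_ne hq
  have hcenter : ∀ᶠ r in 𝓝 q, baseCenter r ∈ Metric.ball (baseCenter q) R := by
    have : Continuous (baseCenter : E d × (Fin d → E d) → E d) := by
      unfold baseCenter
      fun_prop
    exact this.continuousAt (Metric.ball_mem_nhds _ hR)
  have ha : ∀ᶠ r in 𝓝 q, 0 < apexCoord r (baseCenter q + t • (q.1 - baseCenter q)) := by
    have h2 := (continuousAt_apexCoord hq (baseCenter q + t • (q.1 - baseCenter q))).comp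
      (f := fun r : E d × (Fin d → E d) => (r, baseCenter q + t • (q.1 - baseCenter q)))
      (x := q) (by fun_prop)
    refine h2.eventually_const_lt ?_
    simpa [apexCoord_lineMap, hapex, hapex1] using ht0
  filter_upwards [hdet, hp₁, ha, hcenter] with r h3 h4 h5 h6
  exact ⟨h3, fun y hy => h12 h4 (hball y hy), h5, h6⟩

/-- Two faces whose pyramids lie in `T` and look alike in a ball agree in that ball. -/
theorem mem_of_simplex_like {T e e' : Set (E d)} {q q' : E d × (Fin d → E d)} {g a : E d} {R : ℝ}
    (hd : d ≠ 0) (ha : a ∈ Metric.ball g R) (hT : e ⊆ frontier T) (hT' : e' ⊆ frontier T)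
    (hdet : (edgeMatrix q).det ≠ 0) (hdet' : (edgeMatrix q').det ≠ 0)
    (hpos : ∀ y ∈ Metric.ball g R, ∀ i, 0 < baseCoord q y i)
    (hpos' : ∀ y ∈ Metric.ball g R, ∀ i, 0 < baseCoord q' y i)
    (hapex : 0 < apexCoord q a) (hapex' : 0 < apexCoord q' a)
    (he : Convex ℝ e) (he' : Convex ℝ e') (hqe : ∀ i, q.2 i ∈ e) (hqe' : ∀ i, q'.2 i ∈ e')
    (hseg : ∀ x ∈ e, segment ℝ x q.1 ⊆ T) (hseg' : ∀ x ∈ e', segment ℝ x q'.1 ⊆ T)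
    {y : E d} (hy : y ∈ Metric.ball g R) (hy0 : apexCoord q y = 0) : y ∈ e ∧ y ∈ e' := by
  -- In the ball the base coordinates are positive, so a zero apex coordinate means a convex
  -- combination of base vertices, hence a point of the convex face.
  have hface : ∀ {e : Set (E d)} {q : E d × (Fin d → E d)}, (edgeMatrix q).det ≠ 0 →
      (∀ y ∈ Metric.ball g R, ∀ i, 0 < baseCoord q y i) → Convex ℝ e → (∀ i, q.2 i ∈ e) →
      ∀ y ∈ Metric.ball g R, apexCoord q y = 0 → y ∈ e := by
    intro e q hdet hpos he hqe y hy hy0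
    rw [← sum_baseCoord_add_apexCoord hdet y, hy0, zero_smul, add_zero]
    refine he.sum_mem (fun i _ => (hpos y hy i).le) ?_ fun i _ => hqe i
    rw [apexCoord] at hy0
    linarith
  -- With positive apex coordinate the point lies on a segment from a point of `e` to the apex. This
  -- holds throughout an open set, which is therefore in the interior of `T`.
  have hint : ∀ {e : Set (E d)} {q : E d × (Fin d → E d)}, (edgeMatrix q).det ≠ 0 →
      Convex ℝ e → (∀ i, q.2 i ∈ e) → (∀ x ∈ e, segment ℝ x q.1 ⊆ T) →
      (∀ y ∈ Metric.ball g R, ∀ i, 0 < baseCoord q y i) →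
      ∀ y ∈ Metric.ball g R, 0 < apexCoord q y → y ∈ interior T := by
    intro e q hdet he hqe hseg hpos y hy hy0
    have hopen : IsOpen (Metric.ball g R ∩ {y | 0 < apexCoord q y}) :=
      Metric.isOpen_ball.inter (isOpen_lt continuous_const (continuous_apexCoord q))
    refine interior_maximal ?_ hopen ⟨hy, hy0⟩
    rintro z ⟨hz, hz0⟩
    have hz0 : 0 < apexCoord q z := hz0
    have : NeZero d := ⟨hd⟩
    have huniv : (Finset.univ : Finset (Fin d)).Nonempty := Finset.univ_nonempty
    have hs : 0 < ∑ i, baseCoord q z i := Finset.sum_pos (fun i _ => hpos z hz i) huniv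
    have hmem := he.centerMass_mem (t := Finset.univ) (fun i _ => (hpos z hz i).le) hs
      fun i _ => hqe i
    refine hseg _ hmem ⟨∑ i, baseCoord q z i, apexCoord q z, hs.le, hz0.le, by
      rw [apexCoord, add_sub_cancel], ?_⟩
    rw [Finset.centerMass, smul_smul, mul_inv_cancel₀ hs.ne', one_smul,
      sum_baseCoord_add_apexCoord hdet]
  have hnot : ∀ {z}, z ∈ frontier T → z ∈ interior T → False := fun h h' => h.2 h'
  have hye := hface hdet hpos he hqe y hy hy0
  refine ⟨hye, hface hdet' hpos' he' hqe' y hy ?_⟩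
  rcases lt_trichotomy (apexCoord q' y) 0 with h | h | h
  -- On the way from `y` to `a` the second apex coordinate changes sign, so the path meets `e'`, a
  -- part of the frontier. There the first apex coordinate is already positive, which puts the point
  -- in the interior.
  · exfalso
    set α := apexCoord q' y
    set β := apexCoord q' a
    have hαβ : 0 < β - α := by linarith
    set t := -α / (β - α)
    have ht0 : 0 < t := div_pos (by linarith) hαβ
    have ht1 : t ≤ 1 := (div_le_one hαβ).2 (by linarith)
    have hz : y + t • (a - y) ∈ Metric.ball g R :=
      (convex_ball g R).add_smul_sub_mem hy ha ⟨ht0.le, ht1⟩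
    have hz0 : apexCoord q' (y + t • (a - y)) = 0 := by
      rw [apexCoord_lineMap]
      change (1 - t) * α + t * β = 0
      have : t * (β - α) = -α := div_mul_cancel₀ _ hαβ.ne'
      linarith
    refine hnot (hT' (hface hdet' hpos' he' hqe' _ hz hz0)) (hint hdet he hqe hseg hpos _ hz ?_)
    rw [apexCoord_lineMap, hy0]
    simpa using mul_pos ht0 hapex
  · exact h
  · exact (hnot (hT hye) (hint hdet' he' hqe' hseg' hpos' y hy h)).elim

end Simplex

/-! ### The number of convex sides -/

/-- A flat face `e ⊆ frontier T` of surface measure at least `c` that is the base of a pyramid in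
`T` of height at least `σ`. -/
structure IsFatFace {m : ℕ} (T e : Set (E (m + 1))) (c : ENNReal) (σ : ℝ) (A n : E (m + 1))
    (s : ℝ) : Prop where
  apex_mem : A ∈ T
  norm_normal : ‖n‖ = 1
  flat : ∀ x ∈ e, inner ℝ n x = s
  pyramid : ∀ x ∈ e, segment ℝ x A ⊆ T
  height : σ ≤ s - inner ℝ n A
  subset_frontier : e ⊆ frontier T
  measure_ge : c ≤ μHE[m] e

/-- `s - ⟪n, ·⟫` is affine and vanishes at the base vertices, so it equals `apexCoord` times its
nonzero value at the apex. -/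
theorem apexCoord_eq_zero_of_flat {m : ℕ} {q : E (m + 1) × (Fin (m + 1) → E (m + 1))}
    (hq : (edgeMatrix q).det ≠ 0) {n : E (m + 1)} {s : ℝ} (hs : inner ℝ n q.1 ≠ s)
    (hqs : ∀ i, inner ℝ n (q.2 i) = s) {y : E (m + 1)} (hy : inner ℝ n y = s) :
    apexCoord q y = 0 := by
  rw [← add_sum_baseCoord hq y, inner_add_right, inner_sum] at hy
  simp only [inner_smul_right, inner_sub_right, hqs, ← Finset.sum_mul] at hy
  have h : (s - inner ℝ n q.1) * (1 - ∑ i, baseCoord q y i) = 0 := by linarith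
  exact (mul_eq_zero.1 h).resolve_left fun h => hs (by linarith)

/-- Two convex fat faces that look alike overlap in a set of positive surface measure. -/
theorem measure_inter_pos_of_simplex_like {m : ℕ} {T e e' : Set (E (m + 1))} {c : ENNReal} {σ : ℝ}
    (hσ : 0 < σ) {q q' : E (m + 1) × (Fin (m + 1) → E (m + 1))} {g a n n' : E (m + 1)}
    {R s s' : ℝ} (ha : a ∈ Metric.ball g R)
    (hf : IsFatFace T e c σ q.1 n s) (hf' : IsFatFace T e' c σ q'.1 n' s')
    (hdet : (edgeMatrix q).det ≠ 0) (hdet' : (edgeMatrix q').det ≠ 0)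
    (hpos : ∀ y ∈ Metric.ball g R, ∀ i, 0 < baseCoord q y i)
    (hpos' : ∀ y ∈ Metric.ball g R, ∀ i, 0 < baseCoord q' y i)
    (hapex : 0 < apexCoord q a) (hapex' : 0 < apexCoord q' a)
    (he : Convex ℝ e) (he' : Convex ℝ e') (hqe : ∀ i, q.2 i ∈ e) (hqe' : ∀ i, q'.2 i ∈ e')
    (hcenter : baseCenter q ∈ Metric.ball g R) : μHE[m] (e ∩ e') ≠ 0 := by
  obtain ⟨L, hL0, -⟩ := exists_isometry_orthogonal hf.norm_normal
  set x₀ := baseCenter q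
  have hs : inner ℝ n q.1 ≠ s := fun h => by linarith [hf.height]
  have hx₀ : inner ℝ n x₀ = s := by
    have : ((m + 1 : ℕ) : ℝ) ≠ 0 := by exact_mod_cast m.succ_ne_zero
    simp only [x₀, baseCenter, inner_smul_right, inner_sum, hf.flat _ (hqe _), Finset.sum_const,
      Finset.card_univ, Fintype.card_fin, nsmul_eq_mul]
    field_simp
  -- The part of the plane of `e` inside the ball is relatively open and contains the barycenter, so
  -- it has positive area; all of it lies in both faces.
  have hopen : IsOpen ((fun y => x₀ + L y) ⁻¹' Metric.ball g R) :=
    Metric.isOpen_ball.preimage (isometry_const_add x₀ L).continuous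
  have hposU := hopen.measure_pos volume ⟨0, by simpa using hcenter⟩
  rw [← EuclideanSpace.euclideanHausdorffMeasure_eq_volume,
    ← (isometry_const_add x₀ L).euclideanHausdorffMeasure_image] at hposU
  refine (hposU.trans_le (measure_mono ?_)).ne'
  rintro _ ⟨y, hy, rfl⟩
  exact mem_of_simplex_like m.succ_ne_zero ha hf.subset_frontier hf'.subset_frontier hdet hdet'
    hpos hpos' hapex hapex' he he' hqe hqe' hf.pyramid hf'.pyramid hy
    (apexCoord_eq_zero_of_flat hdet hs (fun i => hf.flat _ (hqe i))
      (by rw [inner_add_right, hx₀, hL0, add_zero]))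

/-- The number of convex fat faces of a subset of the unit ball is bounded. -/
theorem exists_card_fatFaces_le (m : ℕ) {c : ENNReal} (hc : 0 < c) {σ : ℝ} (hσ : 0 < σ) :
    ∃ M : ℕ, ∀ T ⊆ Metric.closedBall (0 : E (m + 1)) 1, ∀ F : Finset (Set (E (m + 1))),
      (∀ e ∈ F, Convex ℝ e ∧ ∃ A n s, IsFatFace T e c σ A n s) →
      (∀ e ∈ F, ∀ e' ∈ F, e ≠ e' → μHE[m] (e ∩ e') = 0) → F.card ≤ M := by
  obtain ⟨δ, hδ, hthick⟩ := exists_le_abs_inner_sub_apex m hc hσ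
  -- The compact space of uniformly nondegenerate simplices in the unit ball; every fat face
  -- contributes one.
  let X : Set (E (m + 1) × (Fin (m + 1) → E (m + 1))) :=
    (Metric.closedBall 0 1 ×ˢ Set.pi univ fun _ => Metric.closedBall 0 1) ∩
      {q | δ ^ (m + 1) ≤ |(edgeMatrix q).det|}
  have hX : IsCompact X :=
    ((isCompact_closedBall _ _).prod (isCompact_univ_pi fun _ => isCompact_closedBall _ _)).inter_right
      (isClosed_le continuous_const continuous_edgeMatrix.matrix_det.abs)
  have hXdet : ∀ q ∈ X, (edgeMatrix q).det ≠ 0 := fun q hq h0 => by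
    have : δ ^ (m + 1) ≤ |(edgeMatrix q).det| := hq.2
    rw [h0, abs_zero] at this
    exact this.not_gt (by positivity)
  choose! g a R ha hev using fun q (hq : q ∈ X) =>
    eventually_simplex_like m.succ_ne_zero (hXdet q hq)
  obtain ⟨t, htX, ht⟩ := hX.elim_nhds_subcover _ hev
  refine ⟨t.card, fun T hT F hF hdisj => ?_⟩
  have hF' : ∀ e ∈ F, ∃ q ∈ X, (∀ i, q.2 i ∈ e) ∧ ∃ n s, IsFatFace T e c σ q.1 n s := by
    intro e he
    obtain ⟨-, A, n, s, hf⟩ := hF e he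
    have heT : e ⊆ Metric.closedBall 0 1 := fun x hx =>
      hT (hf.pyramid x hx (left_mem_segment ℝ x A))
    obtain ⟨p, hp, hdet⟩ := exists_det_frameMatrix_ge (K := (fun x : E (m + 1) => x - A) '' e) hδ.le
      fun w => by
        obtain ⟨x, hx, hw⟩ := hthick e A n s heT (hT hf.apex_mem) hf.norm_normal hf.flat hf.height
          hf.measure_ge w
        exact ⟨x - A, ⟨x, hx, rfl⟩, hw⟩
    choose x hx hxp using hp
    refine ⟨(A, x), ⟨⟨hT hf.apex_mem, fun i _ => heT (hx i)⟩, ?_⟩, hx, n, s, hf⟩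
    have : edgeMatrix (A, x) = frameMatrix p := by
      rw [edgeMatrix]
      exact congrArg frameMatrix (funext hxp)
    change δ ^ (m + 1) ≤ |(edgeMatrix (A, x)).det|
    rwa [this]
  choose! q hqX hqe n s hf using hF'
  have hcov : ∀ e ∈ F, ∃ r ∈ t, q e ∈ {r' | (edgeMatrix r').det ≠ 0 ∧
      (∀ y ∈ Metric.ball (g r) (R r), ∀ i, 0 < baseCoord r' y i) ∧
      0 < apexCoord r' (a r) ∧ baseCenter r' ∈ Metric.ball (g r) (R r)} := fun e he => by
    simpa only [mem_iUnion, exists_prop] using ht (hqX e he)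
  choose! r hrt hr using hcov
  -- Pigeonhole: two faces assigned to the same neighbourhood would overlap in positive area.
  refine Finset.card_le_card_of_injOn r hrt fun e he e' he' hee => ?_
  by_contra hne
  obtain ⟨h1, h2, h3, h4⟩ := hr e he
  obtain ⟨h1', h2', h3', -⟩ := hr e' he'
  rw [← hee] at h2' h3'
  exact measure_inter_pos_of_simplex_like hσ (ha _ (htX _ (hrt e he))) (hf e he) (hf e' he') h1 h1'
    h2 h2' h3 h3' (hF e he).1 (hF e' he').1 (hqe e he) (hqe e' he') h4 (hdisj e he e' he' hne)

/-! ### Best approximation by the projection -/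

theorem norm_sq_Lp_eq_integral {n : ℕ} {μ : Measure (E n)} (f : Lp (E n) 2 μ) :
    ‖f‖ ^ 2 = ∫ x, ‖f x‖ ^ 2 ∂μ := by
  rw [← real_inner_self_eq_norm_sq, L2.inner_def]
  simp_rw [real_inner_self_eq_norm_sq]

/-- Rigid motions belong to `V_{k-1}(e)`, and the orthogonal projection minimizes the `L²(e)`
distance to that space. -/
theorem sideErrorSq_le {d k : ℕ} {e : Set (E d)} (he : IsPolytope (d - 1) e) {v r : E d → E d}
    (hv : v ∈ polyField d k) (hr : r ∈ rigidMotion d) :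
    sideErrorSq k v e ≤ ∫ x in e, ‖v x - r x‖ ^ 2 ∂μHE[d - 1] := by
  have hmv := memLp_side he hv
  have hmr := memLp_side he (rigidMotion_le d hr)
  set f := hmv.toLp v
  set P := (sideSpace k e).starProjection f
  have hg : hmr.toLp r ∈ sideSpace k e :=
    ⟨r, Submodule.mem_sup_right hr, hmr.coeFn_toLp⟩
  have hle : ‖f - P‖ ≤ ‖f - hmr.toLp r‖ := by
    rw [Submodule.starProjection_minimal]
    exact ciInf_le ⟨0, by rintro _ ⟨w, rfl⟩; positivity⟩ (⟨_, hg⟩ : sideSpace k e)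
  have h1 : sideErrorSq k v e = ‖f - P‖ ^ 2 := by
    rw [norm_sq_Lp_eq_integral, sideErrorSq]
    have hQ : Qb k e v = P := by rw [Qb, dif_pos hmv]
    refine integral_congr_ae ?_
    filter_upwards [Lp.coeFn_sub f P, hmv.coeFn_toLp] with x h2 h3
    rw [h2, Pi.sub_apply, h3, hQ]
  have h2 : ∫ x in e, ‖v x - r x‖ ^ 2 ∂μHE[d - 1] = ‖f - hmr.toLp r‖ ^ 2 := by
    rw [norm_sq_Lp_eq_integral]
    refine integral_congr_ae ?_
    filter_upwards [Lp.coeFn_sub f (hmr.toLp r), hmv.coeFn_toLp, hmr.coeFn_toLp] with x h2 h3 h4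
    rw [h2, Pi.sub_apply, h3, h4]
  rw [h1, h2]
  gcongr

theorem sideErrorSq_le_of_bound {d k : ℕ} {e : Set (E d)} (he : IsPolytope (d - 1) e)
    {v r : E d → E d} (hv : v ∈ polyField d k) (hr : r ∈ rigidMotion d) {D : ℝ}
    (hD : ∀ x ∈ e, ‖v x - r x‖ ^ 2 ≤ D) :
    sideErrorSq k v e ≤ D * (μHE[d - 1]).real e := by
  refine (sideErrorSq_le he hv hr).trans ((le_abs_self _).trans ?_)
  exact norm_setIntegral_le_of_norm_le_const (f := fun x => ‖v x - r x‖ ^ 2) he.measure_lt_top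
    fun x hx => by simpa using hD x hx

/-! ### Scaling -/

/-- The map `z ↦ x₀ + h z`. -/
def scaleHomeo {d : ℕ} (x₀ : E d) {h : ℝ} (hh : h ≠ 0) : E d ≃ₜ E d :=
  (Homeomorph.smulOfNeZero h hh).trans (Homeomorph.addLeft x₀)

section Scale

variable {d : ℕ} {x₀ : E d} {h : ℝ}

theorem scaleHomeo_apply (hh : h ≠ 0) (z : E d) : scaleHomeo x₀ hh z = x₀ + h • z := rfl

theorem scaleHomeo_symm_apply (hh : h ≠ 0) (x : E d) :
    (scaleHomeo x₀ hh).symm x = h⁻¹ • (x - x₀) := by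
  rw [Homeomorph.symm_apply_eq, scaleHomeo_apply, smul_smul, mul_inv_cancel₀ hh, one_smul,
    add_sub_cancel]

theorem measure_scale (m : ℕ) (hh : 0 < h) (S : Set (E d)) :
    μHE[m] S = ENNReal.ofReal (h ^ m) * μHE[m] (scaleHomeo x₀ hh.ne' ⁻¹' S) := by
  set U := scaleHomeo x₀ hh.ne' ⁻¹' S
  have hS : S = IsometryEquiv.addLeft x₀ '' (h • U) := by
    rw [← image_smul, image_image]
    exact ((scaleHomeo x₀ hh.ne').image_preimage S).symm
  conv_lhs => rw [hS]
  rw [(IsometryEquiv.addLeft x₀).isometry.euclideanHausdorffMeasure_image,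
    Measure.euclideanHausdorffMeasure_smul₀ m hh.ne', ENNReal.smul_def, smul_eq_mul]
  congr 1
  rw [ENNReal.ofReal_pow hh.le, ENNReal.coe_pow, ← enorm_eq_nnnorm, Real.enorm_of_nonneg hh.le]

theorem measureReal_scale (m : ℕ) (hh : 0 < h) (S : Set (E d)) :
    (μHE[m]).real S = h ^ m * (μHE[m]).real (scaleHomeo x₀ hh.ne' ⁻¹' S) := by
  rw [measureReal_def, measure_scale m hh, ENNReal.toReal_mul, ENNReal.toReal_ofReal (by positivity)]
  rfl

theorem mem_scaleHomeo_segment (hh : h ≠ 0) {z A w : E d}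
    (hw : w ∈ segment ℝ z ((scaleHomeo x₀ hh).symm A)) :
    scaleHomeo x₀ hh w ∈ segment ℝ (scaleHomeo x₀ hh z) A := by
  obtain ⟨a, b, ha, hb, hab, rfl⟩ := hw
  refine ⟨a, b, ha, hb, hab, ?_⟩
  conv_lhs => rw [← (scaleHomeo x₀ hh).apply_symm_apply A]
  simp only [scaleHomeo_apply, smul_add]
  rw [smul_comm a h, smul_comm b h, add_add_add_comm, ← add_smul, hab, one_smul]

theorem convex_preimage_scaleHomeo (hh : h ≠ 0) {e : Set (E d)} (he : Convex ℝ e) :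
    Convex ℝ (scaleHomeo x₀ hh ⁻¹' e) := by
  intro x hx y hy a b ha hb hab
  have := he hx hy ha hb hab
  rw [mem_preimage, scaleHomeo_apply]
  simp only [scaleHomeo_apply, smul_add] at this
  rwa [smul_comm a h, smul_comm b h, add_add_add_comm, ← add_smul, hab, one_smul, ← smul_add]
    at this

theorem preimage_scaleHomeo_subset_closedBall (hh : 0 < h) {T : Set (E d)}
    (hT : ∀ x ∈ T, dist x x₀ ≤ h) :
    scaleHomeo x₀ hh.ne' ⁻¹' T ⊆ Metric.closedBall 0 1 := by
  intro z hz
  have := hT _ hz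
  rw [scaleHomeo_apply, dist_eq_norm, add_sub_cancel_left, norm_smul,
    Real.norm_of_nonneg hh.le] at this
  rw [mem_closedBall_zero_iff]
  exact le_of_mul_le_mul_left (by simpa using this) hh

/-- Affine substitutions do not raise the degree, so `[P_k]^d` is preserved by scaling. -/
theorem totalDegree_aeval_le {n : ℕ} (p : MvPolynomial (Fin n) ℝ)
    {f : Fin n → MvPolynomial (Fin n) ℝ} (hf : ∀ j, (f j).totalDegree ≤ 1) :
    (MvPolynomial.aeval f p).totalDegree ≤ p.totalDegree := by
  rw [MvPolynomial.aeval_def, MvPolynomial.eval₂_eq]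
  refine (MvPolynomial.totalDegree_finsetSum _ _).trans (Finset.sup_le fun s hs => ?_)
  refine (MvPolynomial.totalDegree_mul _ _).trans ?_
  rw [MvPolynomial.algebraMap_eq, MvPolynomial.totalDegree_C, zero_add]
  refine (MvPolynomial.totalDegree_finsetProd _ _).trans ?_
  refine le_trans ?_ (MvPolynomial.le_totalDegree hs)
  rw [Finsupp.sum]
  refine Finset.sum_le_sum fun i _ => (MvPolynomial.totalDegree_pow _ _).trans ?_
  exact (Nat.mul_le_mul_left _ (hf i)).trans (mul_one _).le

theorem comp_scaleHomeo_mem_polyField {k : ℕ} {v : E d → E d} (hv : v ∈ polyField d k)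
    (hh : h ≠ 0) : v ∘ scaleHomeo x₀ hh ∈ polyField d k := by
  intro i
  obtain ⟨p, hp, hpv⟩ := hv i
  refine ⟨MvPolynomial.aeval (fun j => MvPolynomial.C (x₀ j) +
    MvPolynomial.C h * MvPolynomial.X j) p, (totalDegree_aeval_le p fun j => ?_).trans hp,
    fun x => ?_⟩
  · refine (MvPolynomial.totalDegree_add _ _).trans (max_le (by simp) ?_)
    exact (MvPolynomial.totalDegree_mul _ _).trans (by simp)
  · have heval : (MvPolynomial.eval fun j => x j).comp (MvPolynomial.aeval (fun j =>
        MvPolynomial.C (x₀ j) + MvPolynomial.C h * MvPolynomial.X j) :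
          MvPolynomial (Fin d) ℝ →ₐ[ℝ] MvPolynomial (Fin d) ℝ).toRingHom =
        MvPolynomial.eval fun j => (scaleHomeo x₀ hh x) j := by
      ext j
      · simp
      · simp [scaleHomeo_apply]
    rw [Function.comp_apply, hpv]
    exact (congrArg (fun f => f p) heval).symm

theorem comp_scaleHomeo_symm_mem_rigidMotion {r : E d → E d} (hr : r ∈ rigidMotion d)
    (hh : h ≠ 0) : r ∘ (scaleHomeo x₀ hh).symm ∈ rigidMotion d := by
  obtain ⟨a, η, hη, hr⟩ := hr
  refine ⟨WithLp.toLp 2 fun i => a i - ∑ j, η i j * (h⁻¹ * x₀ j), h⁻¹ • η, ?_, fun x i => ?_⟩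
  · rw [Matrix.transpose_smul, hη, smul_neg]
  · rw [Function.comp_apply, hr, scaleHomeo_symm_apply]
    simp only [PiLp.smul_apply, PiLp.sub_apply, smul_eq_mul, Matrix.smul_apply, mul_sub,
      Finset.sum_sub_distrib]
    have : ∀ j, h⁻¹ * η i j * x j = η i j * (h⁻¹ * x j) := fun j => by ring
    simp only [this]
    ring

theorem strain_comp_scaleHomeo {v : E d → E d} (hv : Differentiable ℝ v) (hh : h ≠ 0) (z : E d)
    (i j : Fin d) :
    strain (v ∘ scaleHomeo x₀ hh) z i j = h * strain v (scaleHomeo x₀ hh z) i j := by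
  have h1 : HasFDerivAt (scaleHomeo x₀ hh) (h • ContinuousLinearMap.id ℝ (E d)) z :=
    ((hasFDerivAt_id z).const_smul h).const_add x₀
  rw [strain, strain, ((hv _).hasFDerivAt.comp z h1).fderiv]
  simp
  ring

/-- The chain rule contributes `h` to the strain, hence `h²` to its square; the change of variables
contributes `h^{-d}`. -/
theorem strainNormSq_comp_scaleHomeo {v : E d → E d} (hv : Differentiable ℝ v) (hh : 0 < h)
    {T : Set (E d)} (hT : MeasurableSet T) :
    strainNormSq (v ∘ scaleHomeo x₀ hh.ne') (scaleHomeo x₀ hh.ne' ⁻¹' T) =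
      h ^ 2 * (h ^ d)⁻¹ * strainNormSq v T := by
  let f : E d → ℝ := fun x => ∑ i, ∑ j, strain v x i j ^ 2
  have h1 : strainNormSq (v ∘ scaleHomeo x₀ hh.ne') (scaleHomeo x₀ hh.ne' ⁻¹' T) =
      h ^ 2 * ∫ z in scaleHomeo x₀ hh.ne' ⁻¹' T, f (scaleHomeo x₀ hh.ne' z) := by
    rw [← integral_const_mul]
    simp only [strainNormSq, strain_comp_scaleHomeo hv, f, mul_pow, Finset.mul_sum]
  have h2 : ∫ z in scaleHomeo x₀ hh.ne' ⁻¹' T, f (scaleHomeo x₀ hh.ne' z) =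
      (h ^ d)⁻¹ * ∫ x in T, f x := by
    rw [← integral_indicator (hT.preimage (scaleHomeo x₀ hh.ne').measurable),
      ← integral_indicator hT]
    have h3 : ∀ z, (scaleHomeo x₀ hh.ne' ⁻¹' T).indicator (fun z => f (scaleHomeo x₀ hh.ne' z)) z =
        T.indicator f (x₀ + h • z) := fun z => rfl
    simp_rw [h3]
    rw [Measure.integral_comp_smul volume (fun x => T.indicator f (x₀ + x)) h,
      integral_add_left_eq_self (μ := volume) (T.indicator f) x₀, abs_of_nonneg (by positivity),
      smul_eq_mul, finrank_euclideanSpace_fin]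
  rw [h1, h2, mul_assoc]
  rfl

end Scale

/-- A side of a shape regular element is, after scaling, a fat face. -/
theorem exists_isFatFace_preimage {m : ℕ} {T e : Set (E (m + 1))} {c σ θ h : ℝ} (hh : 0 < h)
    {x₀ : E (m + 1)} (hpyr : HasPyramid T e σ θ) (hdiam : Metric.diam T = h)
    (he : e ⊆ frontier T) (hc : c * h ^ m ≤ (μHE[m]).real e) :
    ∃ A n s, IsFatFace (scaleHomeo x₀ hh.ne' ⁻¹' T) (scaleHomeo x₀ hh.ne' ⁻¹' e)
      (ENNReal.ofReal c) σ A n s := by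
  obtain ⟨A, n, s, hA, hn, hflat, hseg, hheight, -⟩ := hpyr
  refine ⟨(scaleHomeo x₀ hh.ne').symm A, n, (s - inner ℝ n x₀) / h, ?_, hn, fun z hz => ?_,
    fun z hz w hw => ?_, ?_, ?_, ?_⟩
  · rwa [mem_preimage, Homeomorph.apply_symm_apply]
  · have := hflat _ hz
    rw [scaleHomeo_apply, inner_add_right, inner_smul_right] at this
    rw [eq_div_iff hh.ne']
    linarith
  · exact hseg (mem_iUnion₂.2 ⟨_, hz, mem_scaleHomeo_segment hh.ne' hw⟩)
  · rw [scaleHomeo_symm_apply, inner_smul_right, inner_sub_right, inv_mul_eq_div, ← sub_div,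
      le_div_iff₀ hh, ← hdiam]
    linarith
  · rw [← (scaleHomeo x₀ hh.ne').preimage_frontier]
    exact preimage_mono he
  · have h1 := measure_scale (x₀ := x₀) m hh e
    have h2 : ENNReal.ofReal (c * h ^ m) ≤ μHE[m] e := ENNReal.ofReal_le_of_le_toReal hc
    rw [h1, mul_comm c, ENNReal.ofReal_mul (by positivity)] at h2
    exact (ENNReal.mul_le_mul_iff_right (by simpa using pow_pos hh m) ENNReal.ofReal_ne_top).1 h2

/-- Ensures that an element has positive diameter and can be rescaled to unit size. -/
theorem IsPolytope.nontrivial {d m : ℕ} {P : Set (E d)} (hm : m ≠ 0) (h : IsPolytope m P) :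
    P.Nontrivial := by
  obtain ⟨-, ⟨S, hS, rfl⟩, hc⟩ := h
  obtain ⟨x, hx⟩ := hc.nonempty
  obtain ⟨s, hs, -⟩ := mem_iUnion₂.1 (intrinsicInterior_subset hx)
  have h1 : 1 < s.card := by
    rw [(hS s hs).1]
    omega
  obtain ⟨a, ha, b, hb, hab⟩ := Finset.one_lt_card.1 h1
  exact ⟨a, mem_iUnion₂.2 ⟨s, hs, subset_convexHull ℝ _ ha⟩, b,
    mem_iUnion₂.2 ⟨s, hs, subset_convexHull ℝ _ hb⟩, hab⟩

/-- The number of sides of a shape regular element is bounded. -/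
theorem exists_card_sides_le (m : ℕ) (s : ShapeParams) :
    ∃ M : ℕ, ∀ (Ω : Set (E (m + 1))) (𝒯 : PolytopalPartition (m + 1) Ω), 𝒯.ShapeRegular s →
      ∀ T ∈ 𝒯.elements, 0 < Metric.diam T → (𝒯.sides T).card ≤ M := by
  classical
  -- Area of a side after scaling: `|e| ≥ ρ_e h_e^m ≥ ρ_e κ^m h_T^m`.
  have hc : 0 < ENNReal.ofReal (s.ρe * s.κ ^ m) := by
    have := s.ρe_pos
    have := s.κ_pos
    rw [ENNReal.ofReal_pos]
    positivity
  obtain ⟨M, hM⟩ := exists_card_fatFaces_le m hc s.σ_pos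
  refine ⟨M + s.N, fun Ω 𝒯 h𝒯 T hT hh => ?_⟩
  have hpoly := 𝒯.isPolytope T hT
  obtain ⟨x₀, hx₀⟩ : T.Nonempty := by
    rw [nonempty_iff_ne_empty]
    rintro rfl
    simp at hh
  have hball := preimage_scaleHomeo_subset_closedBall (x₀ := x₀) hh fun x hx =>
    Metric.dist_le_diam_of_mem hpoly.isCompact.isBounded hx hx₀
  have hinj : Function.Injective fun e => scaleHomeo x₀ hh.ne' ⁻¹' e :=
    (scaleHomeo x₀ hh.ne').surjective.preimage_injective
  rw [← Finset.card_filter_add_card_filter_not (s := 𝒯.sides T) fun e => Convex ℝ e]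
  refine add_le_add ?_ ?_
  · rw [← Finset.card_image_of_injective _ hinj]
    refine hM _ hball _ (fun e₁ he₁ => ?_) fun e₁ he₁ e₂ he₂ hne => ?_
    · obtain ⟨e, he, rfl⟩ := Finset.mem_image.1 he₁
      obtain ⟨he, hconv⟩ := Finset.mem_filter.1 he
      refine ⟨convex_preimage_scaleHomeo hh.ne' hconv, ?_⟩
      refine exists_isFatFace_preimage hh (h𝒯.pyramid T hT e he) rfl ?_ ?_
      · rw [← 𝒯.boundary T hT]
        exact subset_biUnion_of_mem (u := fun e => e) he
      · refine le_trans ?_ (h𝒯.area_ge T hT e he)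
        rw [mul_assoc, ← mul_pow]
        have h1 := h𝒯.diam_side_ge T hT e he
        have h2 := s.ρe_pos
        have h3 := s.κ_pos
        rw [Nat.add_sub_cancel]
        gcongr
    · obtain ⟨e, he, rfl⟩ := Finset.mem_image.1 he₁
      obtain ⟨e', he', rfl⟩ := Finset.mem_image.1 he₂
      have h1 := 𝒯.sides_overlap T hT T hT e (Finset.mem_filter.1 he).1 e'
        (Finset.mem_filter.1 he').1 fun h => hne (by rw [h])
      rw [Nat.add_sub_cancel, measure_scale (x₀ := x₀) m hh, mul_eq_zero] at h1
      exact h1.resolve_left (by simpa using pow_pos hh m)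
  · have h1 := h𝒯.nonconvex_sides T hT
    have h2 : {e | e ∈ 𝒯.sides T ∧ ¬ Convex ℝ e} =
        ((𝒯.sides T).filter fun e => ¬ Convex ℝ e : Finset (Set (E (m + 1)))) := by
      ext e
      simp
    rwa [h2, ncard_coe_finset] at h1

/-- The surface measure of a side is bounded in terms of the diameter of the element. -/
theorem measureReal_side_le {m : ℕ} {T e : Set (E (m + 1))} {σ θ : ℝ} (hT : Bornology.IsBounded T)
    (hh : 0 < Metric.diam T) (he : e ⊆ T) (hpyr : HasPyramid T e σ θ) :
    (μHE[m]).real e ≤ Metric.diam T ^ m * volume.real (Metric.closedBall (0 : E m) 2) := by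
  rcases e.eq_empty_or_nonempty with rfl | ⟨x₀, hx₀⟩
  · simp
    positivity
  obtain ⟨A, n, s, -, hn, hflat, -⟩ := hpyr
  rw [measureReal_scale (x₀ := x₀) m hh]
  gcongr
  refine ENNReal.toReal_mono (measure_closedBall_lt_top).ne ?_
  refine measure_flat_le (s := (s - inner ℝ n x₀) / Metric.diam T)
    (preimage_scaleHomeo_subset_closedBall hh fun x hx =>
      Metric.dist_le_diam_of_mem hT (he hx) (he hx₀)) hn fun z hz => ?_
  have := hflat _ hz
  rw [scaleHomeo_apply, inner_add_right, inner_smul_right] at this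
  rw [eq_div_iff hh.ne']
  linarith

/-- On an element, a polynomial field is close to a rigid motion. -/
theorem exists_rigidMotion_sub_le_of_volume_ge (d k : ℕ) {ρ : ℝ} (hρ : 0 < ρ) :
    ∃ C : ℝ, 0 ≤ C ∧ ∀ T : Set (E d), IsCompact T → 0 < Metric.diam T →
      ρ * Metric.diam T ^ d ≤ volume.real T → ∀ v ∈ polyField d k, ∃ r ∈ rigidMotion d, ∀ x ∈ T,
        ‖v x - r x‖ ^ 2 ≤ C * (Metric.diam T ^ 2 * (Metric.diam T ^ d)⁻¹ * strainNormSq v T) := by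
  obtain ⟨C, hC, h⟩ := exists_rigidMotion_sub_le d k hρ
  refine ⟨C, hC, fun T hT hh hvol v hv => ?_⟩
  obtain ⟨x₀, hx₀⟩ : T.Nonempty := by
    rw [nonempty_iff_ne_empty]
    rintro rfl
    simp at hh
  have hball := preimage_scaleHomeo_subset_closedBall (x₀ := x₀) hh fun x hx =>
    Metric.dist_le_diam_of_mem hT.isBounded hx hx₀
  rw [← EuclideanSpace.euclideanHausdorffMeasure_eq_volume, measureReal_scale (x₀ := x₀) d hh,
    mul_comm] at hvol
  have hvol := le_of_mul_le_mul_left hvol (pow_pos hh d)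
  rw [EuclideanSpace.euclideanHausdorffMeasure_eq_volume] at hvol
  obtain ⟨r, hr, hvr⟩ := h _ (comp_scaleHomeo_mem_polyField hv hh.ne') _ hball hvol
  refine ⟨_, comp_scaleHomeo_symm_mem_rigidMotion hr hh.ne' (x₀ := x₀), fun x hx => ?_⟩
  have := hvr ((scaleHomeo x₀ hh.ne').symm x) (hball (by
    rwa [mem_preimage, Homeomorph.apply_symm_apply]))
  rwa [Function.comp_apply, Homeomorph.apply_symm_apply,
    strainNormSq_comp_scaleHomeo (polyField_differentiable hv) hh hT.measurableSet] at this

end WG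

end

open WG in
theorem mainTheorem7 (d : ℕ) (hd : 2 ≤ d) (k : ℕ) (hk : 1 ≤ k) (s : WG.ShapeParams) :
    ∃ C : ℝ, 0 < C ∧
      ∀ (Ω : Set (WG.E d)), IsOpen Ω → Bornology.IsBounded Ω → IsConnected Ω →
      ∀ 𝒯 : WG.PolytopalPartition d Ω, 𝒯.ShapeRegular s →
      ∀ T ∈ 𝒯.elements, ∀ v₀ ∈ WG.polyField d k,
        𝒯.boundaryErrorSq k v₀ T ≤ C * Metric.diam T * WG.strainNormSq v₀ T := by
  obtain ⟨m, rfl⟩ : ∃ m, d = m + 1 := ⟨d - 1, by omega⟩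
  obtain ⟨M, hM⟩ := exists_card_sides_le m s
  obtain ⟨C, hC, hK⟩ := exists_rigidMotion_sub_le_of_volume_ge (m + 1) k s.ρv_pos
  set V := volume.real (Metric.closedBall (0 : E m) 2)
  -- `M` bounds the number of sides, `V` the area of a rescaled side, and `C` is the Korn constant;
  -- the `+ 1` only makes the result positive.
  refine ⟨M * V * C + 1, by positivity, fun Ω _ _ _ 𝒯 h𝒯 T hT v hv => ?_⟩
  have hpoly := 𝒯.isPolytope T hT
  obtain ⟨x, hx, y, hy, hxy⟩ := hpoly.nontrivial m.succ_ne_zero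
  have hh : 0 < Metric.diam T :=
    (dist_pos.2 hxy).trans_le (Metric.dist_le_diam_of_mem hpoly.isCompact.isBounded hx hy)
  obtain ⟨r, hr, hvr⟩ := hK T hpoly.isCompact hh (h𝒯.volume_ge T hT) v hv
  have hS := strainNormSq_nonneg v T
  set h := Metric.diam T
  set S := strainNormSq v T
  have hside : ∀ e ∈ 𝒯.sides T, sideErrorSq k v e ≤
      C * (h ^ 2 * (h ^ (m + 1))⁻¹ * S) * (h ^ m * V) := by
    intro e he
    have heT : e ⊆ T := by
      refine subset_trans ?_ hpoly.isCompact.isClosed.frontier_subset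
      rw [← 𝒯.boundary T hT]
      exact Set.subset_biUnion_of_mem (u := fun e => e) he
    refine (sideErrorSq_le_of_bound (𝒯.isPolytope_side T hT e he) hv hr
      fun x hx => hvr x (heT hx)).trans ?_
    gcongr
    exact measureReal_side_le hpoly.isCompact.isBounded hh heT (h𝒯.pyramid T hT e he)
  calc 𝒯.boundaryErrorSq k v T
      ≤ (𝒯.sides T).card • (C * (h ^ 2 * (h ^ (m + 1))⁻¹ * S) * (h ^ m * V)) :=
        Finset.sum_le_card_nsmul _ _ _ hside
    _ ≤ M * (C * (h ^ 2 * (h ^ (m + 1))⁻¹ * S) * (h ^ m * V)) := by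
        rw [nsmul_eq_mul]
        gcongr
        exact hM Ω 𝒯 h𝒯 T hT hh
    -- The powers of `h` combine as `2 - (m + 1) + m = 1`.
    _ = M * V * C * h * S := by
        field_simp
        ring
    _ ≤ (M * V * C + 1) * h * S := by
        gcongr
        linarith
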